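/- Let $\alpha,\mu,\lambda,\gamma_0,d_0,R_M>0$, $\kappa\ge 0$, $m>\max(2/\alpha,1)$, $\beta>2$, $\delta\in[2,6]$, $l\in\mathbb N$ and $B_i,\beta_i\in\mathbb R$ ($1\le i\le l$). Put $$c_2=\frac{(m-1)(\beta+2)^{\alpha}}{\lambda^{\alpha/2}\mu\,\beta^{\alpha}},\qquad c_1=\frac{\beta^2\alpha}{8\,\mathrm B(\mu,m)}\,c_2^{\,m},$$ $$\Phi(x;[a_1,a_2,a_3])=[a_1(x+1)]^{a_2}\exp\{a_3[a_1(x+1)+1]\},$$ $$\mathbf v_1(i)=\Big[\tfrac{R_M}{2d_0},\ \beta_i+\tfrac{\alpha\mu\delta}{2},\ \tfrac{\alpha}{2}\kappa\mu d_0\Big],\qquad \mathbf v_2=\Big[\tfrac{R_M}{2d_0},\ \tfrac{\alpha\delta}{2},\ \tfrac{\alpha}{2}\kappa d_0\Big].$$ For $N\in\mathbb N$ let $x_1,\dots,x_N$ be the roots of the Legendre polynomial of order $N$ and $w_1,\dots,w_N$ the corresponding Gauss–Legendre weights on $[-1,1]$. The Fox H-function is $$\mathrm H^{r,n}_{p,q}\Big[z\,\Big|{(a_j,A_j)_{j\le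 p}\atop (b_j,B_j)_{j\le q}}\Big]=\frac1{2\pi \mathrm i}\int_L\frac{\prod_{j\le r}\Gamma(b_j+B_js)\prod_{j\le n}\Gamma(1-a_j-A_js)}{\prod_{j>r}\Gamma(1-b_j-B_js)\prod_{j>n}\Gamma(a_j+A_js)}\,z^{-s}\,ds,$$ where $L$ is a vertical line with the poles of the factors $\Gamma(b_j+B_js)$, $j\le r$, on its left and those of the factors $\Gamma(1-a_j-A_js)$, $j\le n$, on its right. For $\gamma>0$ let $f^{(N)}_\Gamma(\gamma)$ be the Gauss–Legendre form of the density of the signal-to-noise ratio (SNR), $$f^{(N)}_\Gamma(\gamma)=\frac{2R_Mc_1c_2^{-(\mu+m)}}{d_0\gamma_0\Gamma(\mu+m)}\Big(\frac{\gamma}{\gamma_0}\Big)^{\frac{\alpha\mu}2-1}\sum_{i=1}^{l}\sum_{k=1}^{N}B_i\Big(\frac{d_0}{R_M}\Big)^{\beta_i+1}w_k\,\Phi(x_k;\mathbf v_1(i))\,\mathrm H^{3,1}_{3,3}\Big[\tfrac{\Phi(x_k;\mathbf v_2)}{c_2}\big(\tfrac{\gamma}{\gamma_0}\big)^{\frac\alpha2}\Big|{(1-\mu-m,1),(1+\beta-\alpha\mu,\alpha),(1+\beta-\alpha\mu,\alpha)\atop(0,1),(\beta-\alpha\mu,\alpha),(\beta-\alpha\mu,\alpha)}\Big]$$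 and let $$C_N=\frac{2R_Mc_1c_2^{-(\mu+m)}}{\ln(2)\,d_0\Gamma(\mu+m)}\gamma_0^{-\frac{\alpha\mu}2}\sum_{i=1}^{l}\sum_{k=1}^{N}B_i\Big(\frac{d_0}{R_M}\Big)^{\beta_i+1}w_k\,\Phi(x_k;\mathbf v_1(i))\,\mathrm H^{5,2}_{5,5}\Big[\tfrac{\Phi(x_k;\mathbf v_2)}{c_2\gamma_0^{\alpha/2}}\Big|{(1-\mu-m,1),(-\frac{\alpha\mu}2,\frac\alpha2),(1+\beta-\alpha\mu,\alpha),(1+\beta-\alpha\mu,\alpha),(1-\frac{\alpha\mu}2,\frac\alpha2)\atop(0,1),(\beta-\alpha\mu,\alpha),(\beta-\alpha\mu,\alpha),(-\frac{\alpha\mu}2,\frac\alpha2),(-\frac{\alpha\mu}2,\frac\alpha2)}\Big].$$ Then the following hold. 1. For every argument $z>0$, separating vertical lines exist for both H-functions, and on each such line the integral converges absolutely and has the same value. 2. For every $N$, the function $\ln(1+\gamma)f^{(N)}_\Gamma(\gamma)$ is integrable on $(0,\infty)$ and $$\frac1{\ln 2}\int_0^\infty\ln(1+\gamma)\,f^{(N)}_\Gamma(\gamma)\,d\gamma=C_N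 .$$ 3. Let $f_\Gamma$ be the SNR density of the channel itself, $$f_\Gamma(\gamma)=\int_1^{1+R_M/d_0}\frac1{g(d)}f_V\Big(\frac{\gamma}{g(d)}\Big)f_D(d)\,dd,\qquad g(d)=\gamma_0(d-1)^{-\delta}e^{-\kappa d_0d},$$ where $f_D(d)=\sum_{i}B_i(d_0/R_M)^{\beta_i+1}(d-1)^{\beta_i}$, $f_V(v)=\int_0^1\frac1yf_X(v/y)f_Z(y)\,dy$, $f_Z(z)=-\frac{\beta^2}{4}\ln(z)z^{\frac\beta2-1}$ for $0<z<1$, and $f_X(x)=\frac{\alpha}{2\mathrm B(\mu,m)}c_2^{m}x^{\frac{\alpha\mu}2-1}(x^{\frac\alpha2}+c_2)^{-(m+\mu)}$ for $x>0$. If all $\beta_i>0$, then $\ln(1+\gamma)f_\Gamma(\gamma)$ is integrable on $(0,\infty)$ and $$\lim_{N\to\infty}C_N=\frac1{\ln2}\int_0^\infty\ln(1+\gamma)f_\Gamma(\gamma)\,d\gamma .$$ -/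

import Mathlib

namespace THz

/-! ### Fox H-functions -/

/-- The Mellin–Barnes kernel
`∏_{j ≤ m} Γ(b_j + B_j s) ∏_{j ≤ n} Γ(1 - a_j - A_j s) /
 (∏_{j > m} Γ(1 - b_j - B_j s) ∏_{j > n} Γ(a_j + A_j s))`
of the Fox H-function `H^{m,n}_{p,q}` with upper parameters `a j = (a_j, A_j)` and lower parameters
`b j = (b_j, B_j)`. -/
noncomputable def foxHKernel {p q : ℕ} (m n : ℕ) (a : Fin p → ℂ × ℝ) (b : Fin q → ℂ × ℝ)
    (s : ℂ) : ℂ :=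
  (∏ j : Fin q, if (j : ℕ) < m then Complex.Gamma ((b j).1 + (b j).2 * s)
      else (Complex.Gamma (1 - (b j).1 - (b j).2 * s))⁻¹) *
  (∏ j : Fin p, if (j : ℕ) < n then Complex.Gamma (1 - (a j).1 - (a j).2 * s)
      else (Complex.Gamma ((a j).1 + (a j).2 * s))⁻¹)

/-- The vertical line `Re s = c` separates the poles `s = -(b_j + k) / B_j` (`j ≤ m`) of the
Gamma factors `Γ(b_j + B_j s)`, which lie to its left, from the poles `s = (1 - a_j + k) / A_j`
(`j ≤ n`) of the factors `Γ(1 - a_j - A_j s)`, which lie to its right. -/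
def FoxHSeparates {p q : ℕ} (m n : ℕ) (a : Fin p → ℂ × ℝ) (b : Fin q → ℂ × ℝ) (c : ℝ) : Prop :=
  (∀ j : Fin q, (j : ℕ) < m → ∀ k : ℕ, (-((b j).1 + k) / ((b j).2 : ℂ)).re < c) ∧
  (∀ j : Fin p, (j : ℕ) < n → ∀ k : ℕ, c < ((1 - (a j).1 + k) / ((a j).2 : ℂ)).re)

/-- The integrand `kernel(s) z^{-s}` at the point `s = c + i t` of the line `Re s = c`. -/
noncomputable def foxHIntegrand {p q : ℕ} (m n : ℕ) (a : Fin p → ℂ × ℝ) (b : Fin q → ℂ × ℝ)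
    (c : ℝ) (z : ℂ) (t : ℝ) : ℂ :=
  foxHKernel m n a b (c + t * Complex.I) * z ^ (-((c : ℂ) + t * Complex.I))

/-- `(1 / 2πi) ∫_{c - i∞}^{c + i∞} kernel(s) z^{-s} ds`, with `ds = i dt`. -/
noncomputable def foxHLine {p q : ℕ} (m n : ℕ) (a : Fin p → ℂ × ℝ) (b : Fin q → ℂ × ℝ)
    (c : ℝ) (z : ℂ) : ℂ :=
  (1 / (2 * Real.pi : ℂ)) * ∫ t : ℝ, foxHIntegrand m n a b c z t

open Classical in
/-- The Fox H-function `H^{m,n}_{p,q}[z | a ; b]`, with a vertical line that separates the two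
families of poles as its contour (and the value `0` where there is no such line). -/
noncomputable def foxH {p q : ℕ} (m n : ℕ) (a : Fin p → ℂ × ℝ) (b : Fin q → ℂ × ℝ) (z : ℂ) : ℂ :=
  if h : ∃ c : ℝ, FoxHSeparates m n a b c then foxHLine m n a b h.choose z else 0

/-- The Mellin–Barnes integral of `H^{m,n}_{p,q}[z | a ; b]` makes sense: there is a separating
line, and on each of them the integral converges absolutely and has the same value. -/
def FoxHWellDefined {p q : ℕ} (m n : ℕ) (a : Fin p → ℂ × ℝ) (b : Fin q → ℂ × ℝ) (z : ℂ) : Prop :=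
  (∃ c : ℝ, FoxHSeparates m n a b c) ∧
  ∀ c : ℝ, FoxHSeparates m n a b c →
    MeasureTheory.Integrable (foxHIntegrand m n a b c z) ∧ foxHLine m n a b c z = foxH m n a b z

/-! ### Gauss–Legendre quadrature -/

/-- The Legendre polynomial of order `N` (Rodrigues' formula). -/
noncomputable def legendre (N : ℕ) : Polynomial ℝ :=
  Polynomial.C (1 / (2 ^ N * (N.factorial : ℝ))) *
    Polynomial.derivative^[N] ((Polynomial.X ^ 2 - 1) ^ N)

/-- The nodes of the Gauss–Legendre rule of order `N`: the roots of the Legendre polynomial. -/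
noncomputable def glNodes (N : ℕ) : Finset ℝ := (legendre N).roots.toFinset

/-- The weight of the Gauss–Legendre rule of order `N` at the node `x`: the integral over `[-1, 1]`
of the Lagrange basis polynomial of `x`. -/
noncomputable def glWeight (N : ℕ) (x : ℝ) : ℝ :=
  ∫ t in (-1 : ℝ)..1, (Lagrange.basis (glNodes N) id x).eval t

/-! ### The channel -/

/-- The numerical parameters of the channel. -/
structure Params where
  /-- nonlinearity of the propagation medium -/
  α : ℝ
  /-- number of multipath clusters -/
  μ : ℝ
  /-- shadowing parameter -/
  m : ℝ
  /-- beam misalignment parameter -/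
  β : ℝ
  /-- scale parameter of the `α`-`F` distribution -/
  lam : ℝ
  /-- path loss exponent -/
  δ : ℝ
  /-- reference signal-to-noise ratio -/
  γ₀ : ℝ
  /-- specific attenuation coefficient -/
  κ : ℝ
  /-- reference distance -/
  d₀ : ℝ
  /-- maximum separation distance -/
  R : ℝ
  /-- number of terms of the distance density -/
  l : ℕ
  /-- coefficients of the distance density -/
  B : Fin l → ℝ
  /-- exponents of the distance density -/
  b : Fin l → ℝ

namespace Params

variable (P : Params)

/-- Density of the pointing error power `Z = H_p²`. -/
noncomputable def pdfZ (z : ℝ) : ℝ :=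
  if 0 < z ∧ z < 1 then -(P.β ^ 2 / 4) * Real.log z * z ^ (P.β / 2 - 1) else 0

/-- The average fading power `E[H_f²]`. Since `E[Z] = (β / (β + 2))²`, this is the value for which
`E[H_p²] E[H_f²] = 1`. -/
noncomputable def fadingPower : ℝ := ((P.β + 2) / P.β) ^ 2

/-- Density of the `α`-`F` fading power `X = H_f²`. -/
noncomputable def pdfX (x : ℝ) : ℝ :=
  if 0 < x then
    P.α / (2 * ProbabilityTheory.beta P.μ P.m) *
      ((P.m - 1) * P.fadingPower ^ (P.α / 2) / (P.lam ^ (P.α / 2) * P.μ)) ^ P.m *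
      x ^ (P.α * P.μ / 2 - 1) *
      (x ^ (P.α / 2) + (P.m - 1) * P.fadingPower ^ (P.α / 2) / (P.lam ^ (P.α / 2) * P.μ)) ^
        (-(P.m + P.μ))
  else 0

/-- Density of `V = X Z` for independent `X` and `Z`. -/
noncomputable def pdfV (v : ℝ) : ℝ := ∫ y : ℝ, 1 / |y| * P.pdfX (v / y) * P.pdfZ y

/-- The factor `γ₀ (d - 1)^{-δ} exp(-κ d₀ d)`: the SNR at normalized distance `d` is
`Γ(d) = gain d * V`. -/
noncomputable def gain (d : ℝ) : ℝ :=
  P.γ₀ * (d - 1) ^ (-P.δ) * Real.exp (-(P.κ * P.d₀ * d))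

/-- Density of the SNR conditioned on the distance `d`. -/
noncomputable def condPDF (γ d : ℝ) : ℝ := P.pdfV (γ / P.gain d) / P.gain d

/-- Density of the normalized distance `D` on `(1, 1 + R / d₀)` (random waypoint model). -/
noncomputable def pdfD (d : ℝ) : ℝ :=
  ∑ i, P.B i * (P.d₀ / P.R) ^ (P.b i + 1) * (d - 1) ^ P.b i

/-- Density of the SNR. -/
noncomputable def pdfSNR (γ : ℝ) : ℝ :=
  ∫ d in Set.Ioo 1 (1 + P.R / P.d₀), P.condPDF γ d * P.pdfD d

/-! ### Closed forms -/

/-- The constant `c₁`. -/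
noncomputable def c₁ : ℝ :=
  P.β ^ 2 * P.α / (8 * ProbabilityTheory.beta P.μ P.m) *
    ((P.m - 1) * (P.β + 2) ^ P.α / (P.β ^ P.α * P.lam ^ (P.α / 2) * P.μ)) ^ P.m

/-- The constant `c₂`. -/
noncomputable def c₂ : ℝ :=
  (P.m - 1) * (P.β + 2) ^ P.α / (P.lam ^ (P.α / 2) * P.μ * P.β ^ P.α)

/-- `Φ(x; [a₁, a₂, a₃]) = [a₁ (x + 1)]^{a₂} exp(a₃ [a₁ (x + 1) + 1])`. -/
noncomputable def Phi (x a₁ a₂ a₃ : ℝ) : ℝ :=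
  (a₁ * (x + 1)) ^ a₂ * Real.exp (a₃ * (a₁ * (x + 1) + 1))

/-- `Φ(x; v₁(i))`. -/
noncomputable def Phi₁ (i : Fin P.l) (x : ℝ) : ℝ :=
  Phi x (P.R / (2 * P.d₀)) (P.b i + P.α * P.μ * P.δ / 2) (P.α / 2 * P.κ * P.μ * P.d₀)

/-- `Φ(x; v₂)`. -/
noncomputable def Phi₂ (x : ℝ) : ℝ :=
  Phi x (P.R / (2 * P.d₀)) (P.α * P.δ / 2) (P.α / 2 * P.κ * P.d₀)

/-- `H^{3,1}_{3,3}[z | (1-μ-m, 1), (1+β-αμ, α), (1+β-αμ, α) ; (0, 1), (β-αμ, α), (β-αμ, α)]`: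
upper parameters. -/
noncomputable def pdfUpper : Fin 3 → ℂ × ℝ :=
  ![(1 - P.μ - P.m, 1), (1 + P.β - P.α * P.μ, P.α), (1 + P.β - P.α * P.μ, P.α)]

/-- The lower parameters of the same function. -/
noncomputable def pdfLower : Fin 3 → ℂ × ℝ :=
  ![(0, 1), (P.β - P.α * P.μ, P.α), (P.β - P.α * P.μ, P.α)]

/-- The Gauss–Legendre form of order `N` of the density of the SNR. -/
noncomputable def pdfSNRQuadrature (N : ℕ) (γ : ℝ) : ℂ :=
  ((2 * P.R * P.c₁ * P.c₂ ^ (-(P.μ + P.m)) / (P.d₀ * P.γ₀ * Real.Gamma (P.μ + P.m)) *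
      (γ / P.γ₀) ^ (P.α * P.μ / 2 - 1) : ℝ) : ℂ) *
    ∑ i : Fin P.l, ∑ x ∈ glNodes N,
      ((P.B i * (P.d₀ / P.R) ^ (P.b i + 1) * glWeight N x * P.Phi₁ i x : ℝ) : ℂ) *
        foxH 3 1 P.pdfUpper P.pdfLower
          ((P.Phi₂ x / P.c₂ * (γ / P.γ₀) ^ (P.α / 2) : ℝ) : ℂ)

/-- The upper parameters of the function `H^{5,2}_{5,5}` of the average capacity. -/
noncomputable def capUpper : Fin 5 → ℂ × ℝ :=
  ![(1 - P.μ - P.m, 1), (-(P.α * P.μ / 2), P.α / 2), (1 + P.β - P.α * P.μ, P.α),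
    (1 + P.β - P.α * P.μ, P.α), (1 - P.α * P.μ / 2, P.α / 2)]

/-- The lower parameters of the function `H^{5,2}_{5,5}` of the average capacity. -/
noncomputable def capLower : Fin 5 → ℂ × ℝ :=
  ![(0, 1), (P.β - P.α * P.μ, P.α), (P.β - P.α * P.μ, P.α),
    (-(P.α * P.μ / 2), P.α / 2), (-(P.α * P.μ / 2), P.α / 2)]

/-- The closed form of the average capacity, with a Gauss–Legendre rule of order `N`. -/
noncomputable def capacityClosedForm (N : ℕ) : ℂ :=
  ((2 * P.R * P.c₁ * P.c₂ ^ (-(P.μ + P.m)) / (Real.log 2 * P.d₀ * Real.Gamma (P.μ + P.m)) *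
      P.γ₀ ^ (-(P.α * P.μ / 2)) : ℝ) : ℂ) *
    ∑ i : Fin P.l, ∑ x ∈ glNodes N,
      ((P.B i * (P.d₀ / P.R) ^ (P.b i + 1) * glWeight N x * P.Phi₁ i x : ℝ) : ℂ) *
        foxH 5 2 P.capUpper P.capLower ((P.Phi₂ x / (P.c₂ * P.γ₀ ^ (P.α / 2)) : ℝ) : ℂ)

end Params

end THz

/-!
The two H-functions are treated as inverse Mellin transforms of explicit functions on `(0, ∞)`, so
that no contour has to be moved. On a separating line the kernel of `H^{3,1}_{3,3}` is
`Γ(s) Γ(μ + m - s) / (β - α μ + α s) ^ 2`, and the kernel of `H^{5,2}_{5,5}` is the product of this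
function and `Γ(u) Γ(1 - u) / u`, where `u = α (s - μ) / 2`. The factor `Γ(s) Γ(a - s)` is the Mellin
transform of `Γ(a) (1 + x)^{-a}`, the factor `(p + s)^{-2}` that of `-log y * y ^ p` on `(0, 1)`, and
`Γ(u) Γ(1 - u) / u` that of `log (1 + 1 / x)`. As the Mellin transform turns multiplicative
convolution into multiplication (`hasMellin_mulConv`), both kernels are Mellin transforms of
multiplicative convolutions (`densityProfile`, `capacityProfile`). These are continuous, and the
kernels are `O(t ^ (-2))` on vertical lines, so Mellin inversion shows that every separating line
gives the value of the convolution (`foxH_eq_of_hasMellin`).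

The closed form of the capacity integral is then a substitution: `capacityProfile` is by definition
the integral of `log (1 + γ) γ ^ (α μ / 2 - 1)` against a dilation of `densityProfile`.

The density of `V` is itself a power times `densityProfile` (`pdfV_eq`), hence by Fubini the average
capacity is an integral over the distance of terms that involve `capacityProfile`, and the closed
form of order `N` is the Gauss–Legendre sum of this integral. A decreasing function with convergent
Mellin integral at `c` is `O(z ^ (-c))`; with `c` slightly larger than `μ` this makes the terms
continuous up to the end point `d = 1` when the exponents of the distance density are positive, and
Gauss–Legendre quadrature converges for continuous functions (`tendsto_sum_glWeight_mul`). The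
latter rests on the orthogonality of the Legendre polynomials, from which all facts on the nodes
follow (`degree_le_zero_of_dvd_legendre`).
-/

namespace THz

/-! ### Gauss–Legendre quadrature -/

section Quadrature

open Polynomial MeasureTheory

theorem degree_legendre (N : ℕ) : (legendre N).degree = N := by
  have hW : ((X ^ 2 - 1 : ℝ[X]) ^ N).Monic := (monic_X_pow_sub_C (1 : ℝ) two_ne_zero).pow N
  have hd : ((X ^ 2 - 1 : ℝ[X]) ^ N).natDegree = N + N := by
    rw [natDegree_pow, ← C_1, natDegree_X_pow_sub_C]; ring
  have hc : (1 / (2 ^ N * (N.factorial : ℝ))) ≠ 0 := by positivity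
  rw [legendre, degree_C_mul hc]
  apply le_antisymm
  · refine degree_le_of_natDegree_le ((natDegree_iterate_derivative _ N).trans ?_)
    rw [hd]; omega
  · apply le_degree_of_ne_zero
    rw [coeff_iterate_derivative, ← hd, hW.coeff_natDegree, hd]
    simp [Nat.descFactorial_eq_zero_iff_lt]

theorem legendre_ne_zero (N : ℕ) : legendre N ≠ 0 := fun h => by
  have := degree_legendre N
  simp [h] at this

theorem intervalIntegrable_eval (p : ℝ[X]) (a b : ℝ) :
    IntervalIntegrable (fun x => p.eval x) volume a b :=
  p.continuous.intervalIntegrable a b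

/-- The derivatives of order `k ≤ N` of `(X ^ 2 - 1) ^ N` are orthogonal on `[-1, 1]` to the
polynomials of degree less than `k`: integrate by parts, the lower derivatives vanish at `±1`. -/
theorem integral_iterate_derivative_mul_eq_zero (N k : ℕ) (hk : k ≤ N) (q : ℝ[X])
    (hq : q.degree < k) :
    ∫ x in (-1 : ℝ)..1, (derivative^[k] ((X ^ 2 - 1 : ℝ[X]) ^ N) * q).eval x = 0 := by
  induction k generalizing q with
  | zero =>
    have : q = 0 := by simpa [Nat.WithBot.lt_zero_iff] using hq
    simp [this]
  | succ k ih =>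
    have hdvd : (X ^ 2 - 1 : ℝ[X]) ∣ derivative^[k] ((X ^ 2 - 1 : ℝ[X]) ^ N) :=
      (dvd_pow_self _ (by omega : N - k ≠ 0)).trans (pow_sub_dvd_iterate_derivative_pow _ N k)
    set F := derivative^[k] ((X ^ 2 - 1 : ℝ[X]) ^ N) with hF
    have hb : ∀ x : ℝ, x ^ 2 = 1 → F.eval x = 0 := by
      intro x hx
      obtain ⟨r, hr⟩ := hdvd
      simp [hr, hx]
    have hq' : (derivative q).degree < k := by
      rcases eq_or_ne q 0 with rfl | h0
      · simp
      · refine (degree_derivative_lt h0).trans_le ?_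
        rw [degree_eq_natDegree h0] at hq ⊢
        norm_cast at hq ⊢
        omega
    rw [Function.iterate_succ_apply', ← hF]
    have hparts := intervalIntegral.integral_mul_deriv_eq_deriv_mul (a := -1) (b := 1)
      (u := fun x => q.eval x) (v := fun x => F.eval x)
      (fun x _ => q.hasDerivAt x) (fun x _ => F.hasDerivAt x)
      (intervalIntegrable_eval _ _ _) (intervalIntegrable_eval _ _ _)
    have hz := ih (by omega) _ hq'
    simp only [eval_mul] at hz ⊢
    simp only [mul_comm (eval _ (derivative F))]
    rw [hparts, hb 1 (by norm_num), hb (-1) (by norm_num)]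
    simp only [mul_comm (eval _ (derivative q)), hz]
    simp

theorem integral_legendre_mul_eq_zero (N : ℕ) (q : ℝ[X]) (hq : q.degree < N) :
    ∫ x in (-1 : ℝ)..1, (legendre N * q).eval x = 0 := by
  have := integral_iterate_derivative_mul_eq_zero N N le_rfl q hq
  simp only [legendre, mul_assoc, eval_C_mul, intervalIntegral.integral_const_mul, this, mul_zero]

theorem integral_eval_pos {p : ℝ[X]} (hp : p ≠ 0) (h : ∀ x ∈ Set.Icc (-1 : ℝ) 1, 0 ≤ p.eval x) :
    0 < ∫ x in (-1 : ℝ)..1, p.eval x := by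
  refine intervalIntegral.integral_pos (by norm_num) p.continuous.continuousOn
    (fun x hx => h x (Set.Ioc_subset_Icc_self hx)) ?_
  by_contra! hc
  refine hp (eq_zero_of_infinite_isRoot p ?_)
  exact (Set.Icc_infinite (by norm_num : (-1 : ℝ) < 1)).mono
    fun x hx => le_antisymm (hc x hx) (h x hx)

/-- A factorization `q * r` of the Legendre polynomial with `r ≥ 0` on `[-1, 1]` and `r` of positive
degree would make `∫ q * legendre N = ∫ q ^ 2 * r` positive, against orthogonality. All the
information on the roots comes from this. -/
theorem degree_le_zero_of_dvd_legendre {N : ℕ} {r : ℝ[X]} (hr : r ∣ legendre N)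
    (h : ∀ x ∈ Set.Icc (-1 : ℝ) 1, 0 ≤ r.eval x) : r.degree ≤ 0 := by
  by_contra! hd
  obtain ⟨q, hq⟩ := hr
  have h0 := legendre_ne_zero N
  have hq0 : q ≠ 0 := by rintro rfl; simp [hq] at h0
  have hr0 : r ≠ 0 := by rintro rfl; simp [hq] at h0
  have hdeg : q.degree < N := by
    rw [← degree_legendre N, hq, degree_mul, degree_eq_natDegree hq0, degree_eq_natDegree hr0]
    rw [degree_eq_natDegree hr0] at hd
    norm_cast at hd ⊢
    omega
  have hz := integral_legendre_mul_eq_zero N q hdeg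
  have hpos := integral_eval_pos (p := legendre N * q) (mul_ne_zero h0 hq0) (by
    intro x hx
    rw [hq, eval_mul, eval_mul]
    nlinarith [mul_nonneg (h x hx) (sq_nonneg (q.eval x))])
  exact hpos.ne' hz

theorem mem_Ioo_of_mem_glNodes {N : ℕ} {x : ℝ} (hx : x ∈ glNodes N) : x ∈ Set.Ioo (-1 : ℝ) 1 := by
  have hroot : X - C x ∣ legendre N := by
    rw [dvd_iff_isRoot]
    exact (mem_roots'.mp (by simpa [glNodes] using hx)).2
  constructor
  · by_contra! h
    have := degree_le_zero_of_dvd_legendre hroot (fun y hy => by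
      simp only [eval_sub, eval_X, eval_C]; linarith [hy.1])
    rw [degree_X_sub_C] at this
    exact absurd this (by decide)
  · by_contra! h
    have := degree_le_zero_of_dvd_legendre ((neg_dvd (α := ℝ[X])).mpr hroot) (fun y hy => by
      simp only [eval_neg, eval_sub, eval_X, eval_C]; linarith [hy.2])
    rw [degree_neg, degree_X_sub_C] at this
    exact absurd this (by decide)

theorem splits_legendre (N : ℕ) : (legendre N).Splits := by
  obtain ⟨u, hu⟩ := UniqueFactorizationMonoid.factors_prod (legendre_ne_zero N)
  rw [← hu]
  refine (Splits.multisetProd fun g hmem => Splits.of_degree_eq_one ?_).mul u.isUnit.splits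
  have hg := UniqueFactorizationMonoid.irreducible_of_factor g hmem
  have hdvd := UniqueFactorizationMonoid.dvd_of_mem_factors hmem
  by_contra hne
  have hroot : ∀ x, g.eval x ≠ 0 := fun x hx => hne (degree_eq_one_of_irreducible_of_root hg hx)
  have hdeg : 0 < g.degree := degree_pos_of_irreducible hg
  -- a real polynomial without real roots has constant sign
  have hsign : (∀ x, 0 ≤ g.eval x) ∨ ∀ x, 0 ≤ (-g).eval x := by
    by_contra! h
    obtain ⟨⟨a, ha⟩, b, hb⟩ := h
    rw [eval_neg] at hb
    obtain ⟨c, hc⟩ := mem_range_of_exists_le_of_exists_ge g.continuous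
      (⟨a, ha.le⟩ : ∃ a, g.eval a ≤ 0) (⟨b, by linarith⟩ : ∃ b, 0 ≤ g.eval b)
    exact hroot c hc
  rcases hsign with h | h
  · exact absurd (degree_le_zero_of_dvd_legendre hdvd fun x _ => h x) (not_le.mpr hdeg)
  · have := degree_le_zero_of_dvd_legendre ((neg_dvd (α := ℝ[X])).mpr hdvd) fun x _ => h x
    rw [degree_neg] at this
    exact absurd this (not_le.mpr hdeg)

theorem card_glNodes (N : ℕ) : (glNodes N).card = N := by
  have hnodup : (legendre N).roots.Nodup := by
    rw [Multiset.nodup_iff_count_le_one]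
    intro x
    by_contra! h
    rw [count_roots, Nat.lt_iff_add_one_le, le_rootMultiplicity_iff (legendre_ne_zero N)] at h
    have := degree_le_zero_of_dvd_legendre h (fun y _ => by
      rw [eval_pow]; exact sq_nonneg _)
    rw [degree_pow, degree_X_sub_C] at this
    exact absurd this (by decide)
  rw [glNodes, Multiset.toFinset_card_of_nodup hnodup, ← (splits_legendre N).natDegree_eq_card_roots]
  exact natDegree_eq_of_degree_eq_some (degree_legendre N)

theorem eval_legendre_of_mem_glNodes {N : ℕ} {x : ℝ} (hx : x ∈ glNodes N) :
    (legendre N).eval x = 0 :=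
  (mem_roots'.mp (by simpa [glNodes] using hx)).2

/-- The rule of order `N` is exact up to degree `2 * N - 1`. -/
theorem sum_glWeight_mul_eval {N : ℕ} {p : ℝ[X]} (hp : p.degree < (2 * N : ℕ)) :
    ∑ x ∈ glNodes N, glWeight N x * p.eval x = ∫ x in (-1 : ℝ)..1, p.eval x := by
  have h0 := legendre_ne_zero N
  have hdm := EuclideanDomain.div_add_mod p (legendre N)
  set q := p / legendre N with hq
  set r := p % legendre N with hr
  have hrd : r.degree < N := by
    rw [← degree_legendre N]; exact degree_mod_lt p h0
  have hqd : q.degree < N := by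
    rcases eq_or_ne q 0 with hq0 | hq0
    · rw [hq0, degree_zero]; exact WithBot.bot_lt_coe _
    have hle : (legendre N).degree ≤ p.degree := by
      by_contra! hlt
      exact hq0 ((Polynomial.div_eq_zero_iff h0).mpr hlt)
    have := degree_add_div h0 hle
    rw [degree_legendre, ← hq] at this
    rw [← this, degree_eq_natDegree hq0] at hp
    rw [degree_eq_natDegree hq0]
    norm_cast at hp ⊢
    omega
  have hnode : ∀ x ∈ glNodes N, p.eval x = r.eval x := fun x hx => by
    rw [← hdm, eval_add, eval_mul, eval_legendre_of_mem_glNodes hx]; simp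
  have hint : ∫ x in (-1 : ℝ)..1, p.eval x = ∫ x in (-1 : ℝ)..1, r.eval x := by
    conv_lhs => rw [← hdm]
    simp only [eval_add]
    rw [intervalIntegral.integral_add (intervalIntegrable_eval _ _ _)
      (intervalIntegrable_eval _ _ _), integral_legendre_mul_eq_zero N q hqd, zero_add]
  have hinterp := Lagrange.eq_interpolate (s := glNodes N) (v := id) (f := r)
    Function.injective_id.injOn (by rw [card_glNodes]; exact hrd)
  rw [hint, hinterp, Lagrange.interpolate_apply]
  simp only [eval_finsetSum, eval_C_mul, id]
  rw [intervalIntegral.integral_finsetSum fun x _ =>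
    (intervalIntegrable_eval _ _ _).const_mul _]
  refine Finset.sum_congr rfl fun x hx => ?_
  rw [hnode x hx, intervalIntegral.integral_const_mul, glWeight, mul_comm]

theorem glWeight_nonneg {N : ℕ} {x : ℝ} (hx : x ∈ glNodes N) : 0 ≤ glWeight N x := by
  set p := Lagrange.basis (glNodes N) id x
  have hinj : Set.InjOn (id : ℝ → ℝ) (glNodes N) := Function.injective_id.injOn
  have hN : 0 < N := by
    rw [← card_glNodes N]; exact Finset.card_pos.mpr ⟨x, hx⟩
  have hd : (p ^ 2).degree < (2 * N : ℕ) := by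
    rw [degree_pow, Lagrange.degree_basis hinj hx, card_glNodes]
    rw [nsmul_eq_mul]
    exact_mod_cast (by omega : 2 * (N - 1) < 2 * N)
  have h1 := sum_glWeight_mul_eval hd
  rw [Finset.sum_eq_single_of_mem x hx (fun y hy hyx => by
      have : p.eval y = 0 := Lagrange.eval_basis_of_ne (v := id) (Ne.symm hyx) hy
      simp [this])] at h1
  have h2 : p.eval x = 1 := Lagrange.eval_basis_self (v := id) hinj hx
  rw [eval_pow, h2, one_pow, mul_one] at h1
  rw [h1]
  exact intervalIntegral.integral_nonneg (by norm_num) fun y _ => by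
    rw [eval_pow]; positivity

theorem sum_glWeight {N : ℕ} (hN : 0 < N) : ∑ x ∈ glNodes N, glWeight N x = 2 := by
  have := sum_glWeight_mul_eval (N := N) (p := 1) (by
    rw [degree_one]; exact_mod_cast (by omega : 0 < 2 * N))
  simp only [eval_one, mul_one, intervalIntegral.integral_const, smul_eq_mul] at this
  rw [this]; norm_num

/-- Convergence of Gauss–Legendre quadrature: approximate by a polynomial, for which the rule is
eventually exact, and bound the error with the nonnegative weights, whose sum is `2`. -/
theorem tendsto_sum_glWeight_mul {f : ℝ → ℝ} (hf : ContinuousOn f (Set.Icc (-1) 1)) :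
    Filter.Tendsto (fun N => ∑ x ∈ glNodes N, glWeight N x * f x) Filter.atTop
      (nhds (∫ x in (-1 : ℝ)..1, f x)) := by
  rw [Metric.tendsto_atTop]
  intro ε hε
  obtain ⟨p, hp⟩ := exists_polynomial_near_of_continuousOn (-1) 1 f hf (ε / 8) (by positivity)
  refine ⟨p.natDegree + 1, fun N hN => ?_⟩
  have hexact : ∑ x ∈ glNodes N, glWeight N x * p.eval x = ∫ x in (-1 : ℝ)..1, p.eval x := by
    refine sum_glWeight_mul_eval (degree_le_natDegree.trans_lt ?_)
    exact_mod_cast (by omega : p.natDegree < 2 * N)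
  have h1 : |∑ x ∈ glNodes N, glWeight N x * f x - ∑ x ∈ glNodes N, glWeight N x * p.eval x|
      ≤ 2 * (ε / 8) := by
    rw [← Finset.sum_sub_distrib, ← sum_glWeight (by omega : 0 < N), Finset.sum_mul]
    refine (Finset.abs_sum_le_sum_abs _ _).trans (Finset.sum_le_sum fun x hx => ?_)
    rw [← mul_sub, abs_mul, abs_of_nonneg (glWeight_nonneg hx), abs_sub_comm]
    exact mul_le_mul_of_nonneg_left
      (hp x (Set.Ioo_subset_Icc_self (mem_Ioo_of_mem_glNodes hx))).le (glWeight_nonneg hx)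
  have hfi : IntervalIntegrable f volume (-1) 1 :=
    ContinuousOn.intervalIntegrable (by rwa [Set.uIcc_of_le (by norm_num)])
  have h2 : |(∫ x in (-1 : ℝ)..1, p.eval x) - ∫ x in (-1 : ℝ)..1, f x| ≤ 2 * (ε / 8) := by
    rw [← intervalIntegral.integral_sub (intervalIntegrable_eval _ _ _) hfi]
    have := intervalIntegral.norm_integral_le_of_norm_le_const (a := -1) (b := 1) (C := ε / 8)
      (f := fun x => p.eval x - f x) (fun x hx => by
        rw [Set.uIoc_of_le (by norm_num)] at hx
        exact (hp x (Set.Ioc_subset_Icc_self hx)).le)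
    rw [Real.norm_eq_abs] at this
    refine this.trans (le_of_eq ?_)
    norm_num
    ring
  rw [Real.dist_eq]
  calc _ ≤ _ := abs_sub_le _ (∑ x ∈ glNodes N, glWeight N x * p.eval x) _
    _ ≤ 2 * (ε / 8) + 2 * (ε / 8) := add_le_add h1 (by rw [hexact]; exact h2)
    _ < ε := by linarith

end Quadrature

open MeasureTheory Set

/-! ### Multiplicative convolution and the Mellin transform -/

/-- The multiplicative convolution `z ↦ ∫ f (z / y) g (y) dy / y` of two functions on `(0, ∞)`. -/
noncomputable def mulConv (f g : ℝ → ℝ) (z : ℝ) : ℝ := ∫ y in Ioi (0 : ℝ), f (z / y) * g y / y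

/-- A measurable function whose restriction to `(0, ∞)` is nonnegative, decreasing and continuous.
Nothing is required of the values on `(-∞, 0]`. -/
structure IsDecayProfile (f : ℝ → ℝ) : Prop where
  measurable : Measurable f
  nonneg : ∀ x, 0 < x → 0 ≤ f x
  antitoneOn : AntitoneOn f (Ioi 0)
  continuousOn : ContinuousOn f (Ioi 0)

theorem mellinConvergent_ofReal_iff {f : ℝ → ℝ} (hf : Measurable f) (s : ℂ) :
    MellinConvergent (fun x => (f x : ℂ)) s ↔
      IntegrableOn (fun x : ℝ => x ^ (s.re - 1) * ‖f x‖) (Ioi 0) := by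
  have hm : AEStronglyMeasurable (fun x : ℝ => (x : ℂ) ^ (s - 1) • (f x : ℂ))
      (volume.restrict (Ioi 0)) := by
    refine Measurable.aestronglyMeasurable ?_
    simp only [smul_eq_mul]
    fun_prop
  rw [MellinConvergent, IntegrableOn, ← integrable_norm_iff hm]
  refine integrableOn_congr_fun (fun x hx => ?_) measurableSet_Ioi
  simp only [norm_smul, Complex.norm_real, Complex.norm_cpow_eq_rpow_re_of_pos hx, Complex.sub_re,
    Complex.one_re]

theorem integrable_prod_mulConv {f g : ℝ → ℝ} (hf : Measurable f) (hg : Measurable g) {s : ℂ}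
    (hfs : MellinConvergent (fun x => (f x : ℂ)) s)
    (hgs : MellinConvergent (fun x => (g x : ℂ)) s) :
    Integrable (fun q : ℝ × ℝ => (q.1 : ℂ) ^ (s - 1) * ((f (q.1 / q.2) * g q.2 / q.2 : ℝ) : ℂ))
      ((volume.restrict (Ioi 0)).prod (volume.restrict (Ioi 0))) := by
  have hmeas : Measurable
      (fun q : ℝ × ℝ => (q.1 : ℂ) ^ (s - 1) * ((f (q.1 / q.2) * g q.2 / q.2 : ℝ) : ℂ)) := by
    fun_prop
  rw [integrable_prod_iff' hmeas.aestronglyMeasurable]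
  constructor
  · refine (ae_restrict_iff' measurableSet_Ioi).mpr (ae_of_all _ fun y hy => ?_)
    have := (MellinConvergent.comp_mul_left (inv_pos.mpr hy)).mpr hfs
    refine (Integrable.const_mul this ((g y / y : ℝ) : ℂ)).congr (ae_of_all _ fun z => ?_)
    simp only [smul_eq_mul, div_eq_inv_mul z]
    push_cast
    ring
  · have hA := ((mellinConvergent_ofReal_iff hg s).mp hgs).mul_const
      (∫ x in Ioi (0 : ℝ), x ^ (s.re - 1) * ‖f x‖)
    refine hA.congr ((ae_restrict_iff' measurableSet_Ioi).mpr (ae_of_all _ fun y hy => ?_))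
    have hy : (0 : ℝ) < y := hy
    have hsub := integral_comp_mul_left_Ioi (fun x : ℝ => x ^ (s.re - 1) * ‖f x‖) 0
      (inv_pos.mpr hy)
    rw [mul_zero, inv_inv, smul_eq_mul] at hsub
    have heq : ∀ z ∈ Ioi (0 : ℝ),
        ‖(z : ℂ) ^ (s - 1) * ((f (z / y) * g y / y : ℝ) : ℂ)‖ =
          y ^ (s.re - 1) * ‖g y‖ / y * ((y⁻¹ * z) ^ (s.re - 1) * ‖f (y⁻¹ * z)‖) := by
      intro z hz
      have hz : (0 : ℝ) < z := hz
      rw [norm_mul, Complex.norm_cpow_eq_rpow_re_of_pos hz, Complex.norm_real, norm_div, norm_mul,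
        Real.norm_of_nonneg hy.le, Real.mul_rpow (inv_pos.mpr hy).le hz.le,
        Real.inv_rpow hy.le, div_eq_inv_mul z, Complex.sub_re, Complex.one_re]
      have := (Real.rpow_pos_of_pos hy (s.re - 1)).ne'
      field_simp
    dsimp only
    rw [setIntegral_congr_fun measurableSet_Ioi heq, integral_const_mul, hsub]
    field_simp

theorem measurable_mulConv {f g : ℝ → ℝ} (hf : Measurable f) (hg : Measurable g) :
    Measurable (mulConv f g) := by
  have : StronglyMeasurable (fun q : ℝ × ℝ => f (q.1 / q.2) * g q.2 / q.2) :=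
    Measurable.stronglyMeasurable (by fun_prop)
  exact this.integral_prod_right.measurable

/-- The Mellin transform turns multiplicative convolution into multiplication. -/
theorem hasMellin_mulConv {f g : ℝ → ℝ} (hf : Measurable f) (hg : Measurable g) {s M M' : ℂ}
    (hfs : HasMellin (fun x => (f x : ℂ)) s M) (hgs : HasMellin (fun x => (g x : ℂ)) s M') :
    HasMellin (fun x => (mulConv f g x : ℂ)) s (M * M') := by
  have hint := integrable_prod_mulConv hf hg hfs.1 hgs.1
  have hz : ∀ z : ℝ, (z : ℂ) ^ (s - 1) • (mulConv f g z : ℂ) =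
      ∫ y in Ioi (0 : ℝ), (z : ℂ) ^ (s - 1) * ((f (z / y) * g y / y : ℝ) : ℂ) := by
    intro z
    rw [integral_const_mul, integral_complex_ofReal]
    rfl
  constructor
  · rw [MellinConvergent, IntegrableOn]
    simp only [hz]
    exact hint.integral_prod_left
  · simp only [mellin, hz]
    rw [integral_integral_swap hint, ← hfs.2, ← hgs.2, mul_comm, mellin.eq_def (fun x => (g x : ℂ)),
      ← integral_mul_const]
    refine setIntegral_congr_fun measurableSet_Ioi fun y hy => ?_
    have hy : (0 : ℝ) < y := hy
    have h1 := mellin_comp_mul_left (fun x => (f x : ℂ)) s (inv_pos.mpr hy)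
    have h2 : ∀ z : ℝ, (z : ℂ) ^ (s - 1) * ((f (z / y) * g y / y : ℝ) : ℂ) =
        (g y / y : ℝ) * ((z : ℂ) ^ (s - 1) • (f (y⁻¹ * z) : ℂ)) := fun z => by
      simp only [smul_eq_mul, div_eq_inv_mul z]
      push_cast
      ring
    simp only [h2]
    rw [integral_const_mul]
    rw [mellin.eq_def (fun t : ℝ => (f (y⁻¹ * t) : ℂ))] at h1
    have hy' : (y : ℂ) ≠ 0 := by exact_mod_cast hy.ne'
    rw [h1, Complex.ofReal_inv, Complex.inv_cpow, Complex.cpow_neg, inv_inv,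
      Complex.cpow_sub _ _ hy', Complex.cpow_one]
    · simp only [smul_eq_mul]
      push_cast
      ring
    · rw [Complex.arg_ofReal_of_nonneg hy.le]
      exact Real.pi_pos.ne

namespace IsDecayProfile

variable {f g : ℝ → ℝ} {σ : ℝ}

/-- A decreasing function with convergent Mellin integral at `σ > 0` is `O(x ^ (-σ))`, since
`f x * x ^ σ / σ ≤ ∫ t in 0..x, t ^ (σ - 1) * f t`. -/
theorem exists_le_rpow (hf : IsDecayProfile f) (hσ : 0 < σ)
    (h : MellinConvergent (fun x => (f x : ℂ)) σ) :
    ∃ C, 0 ≤ C ∧ ∀ x, 0 < x → f x ≤ C * x ^ (-σ) := by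
  rw [mellinConvergent_ofReal_iff hf.measurable, Complex.ofReal_re] at h
  refine ⟨σ * ∫ x in Ioi (0 : ℝ), x ^ (σ - 1) * ‖f x‖, ?_, fun x hx => ?_⟩
  · refine mul_nonneg hσ.le (setIntegral_nonneg measurableSet_Ioi fun x hx => ?_)
    exact mul_nonneg (Real.rpow_nonneg (le_of_lt hx) _) (norm_nonneg _)
  · have hpow : ∫ t in Ioc 0 x, t ^ (σ - 1) = x ^ σ / σ := by
      rw [← intervalIntegral.integral_of_le hx.le, integral_rpow (Or.inl (by linarith)),
        sub_add_cancel, Real.zero_rpow hσ.ne', sub_zero]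
    have hi : IntegrableOn (fun t : ℝ => t ^ (σ - 1)) (Ioc 0 x) := by
      rw [← intervalIntegrable_iff_integrableOn_Ioc_of_le hx.le]
      exact intervalIntegral.intervalIntegrable_rpow' (by linarith)
    have h1 : x ^ σ / σ * f x ≤ ∫ t in Ioi (0 : ℝ), t ^ (σ - 1) * ‖f t‖ := by
      rw [← hpow, ← integral_mul_const]
      refine (setIntegral_mono_on (hi.mul_const _) (h.mono_set Ioc_subset_Ioi_self)
        measurableSet_Ioc fun t ht => ?_).trans
        (setIntegral_mono_set h ?_ (Filter.Eventually.of_forall Ioc_subset_Ioi_self))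
      · exact mul_le_mul_of_nonneg_left ((hf.antitoneOn ht.1 hx ht.2).trans (le_abs_self _))
          (Real.rpow_nonneg ht.1.le _)
      · refine (ae_restrict_iff' measurableSet_Ioi).mpr (ae_of_all _ fun t ht => ?_)
        exact mul_nonneg (Real.rpow_nonneg (le_of_lt ht) _) (norm_nonneg _)
    have hxσ := Real.rpow_pos_of_pos hx σ
    rw [Real.rpow_neg hx.le]
    calc f x = σ * (x ^ σ / σ * f x) * (x ^ σ)⁻¹ := by field_simp
      _ ≤ _ := by gcongr

theorem integrableOn_rpow_mul (hg : Measurable g)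
    (h : MellinConvergent (fun x => (g x : ℂ)) σ) (C : ℝ) :
    IntegrableOn (fun y : ℝ => C * (y ^ (σ - 1) * ‖g y‖)) (Ioi 0) := by
  rw [mellinConvergent_ofReal_iff hg, Complex.ofReal_re] at h
  exact h.const_mul C

theorem norm_mulConv_integrand_le (hf : IsDecayProfile f) {C x z y : ℝ}
    (hC : ∀ x, 0 < x → f x ≤ C * x ^ (-σ)) (hx : 0 < x) (hz : x ≤ z) (hy : 0 < y) :
    ‖f (z / y) * g y / y‖ ≤ C * x ^ (-σ) * (y ^ (σ - 1) * ‖g y‖) := by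
  have hzy : 0 < z / y := div_pos (hx.trans_le hz) hy
  have hxy : 0 < x / y := div_pos hx hy
  rw [norm_div, norm_mul, Real.norm_of_nonneg (hf.nonneg _ hzy), Real.norm_of_nonneg hy.le]
  have h1 : f (z / y) ≤ C * (x / y) ^ (-σ) :=
    (hf.antitoneOn hxy hzy (by gcongr)).trans (hC _ hxy)
  calc f (z / y) * ‖g y‖ / y ≤ C * (x / y) ^ (-σ) * ‖g y‖ / y := by gcongr
    _ = _ := by
      rw [Real.div_rpow hx.le hy.le, Real.rpow_neg hy.le, Real.rpow_sub hy, Real.rpow_one]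
      have := (Real.rpow_pos_of_pos hy σ).ne'
      field_simp

theorem integrableOn_mulConv (hf : IsDecayProfile f) (hg : Measurable g) (hσ : 0 < σ)
    (hfσ : MellinConvergent (fun x => (f x : ℂ)) σ)
    (hgσ : MellinConvergent (fun x => (g x : ℂ)) σ) {z : ℝ} (hz : 0 < z) :
    IntegrableOn (fun y => f (z / y) * g y / y) (Ioi 0) := by
  obtain ⟨C, -, hC⟩ := hf.exists_le_rpow hσ hfσ
  have := hf.measurable
  refine (integrableOn_rpow_mul hg hgσ (C * z ^ (-σ))).mono'
    (Measurable.aestronglyMeasurable (by fun_prop)) ?_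
  exact (ae_restrict_iff' measurableSet_Ioi).mpr
    (ae_of_all _ fun y hy => hf.norm_mulConv_integrand_le hC hz le_rfl hy)

protected theorem mulConv (hf : IsDecayProfile f) (hg : Measurable g) (hg0 : ∀ y, 0 < y → 0 ≤ g y)
    (hσ : 0 < σ) (hfσ : MellinConvergent (fun x => (f x : ℂ)) σ)
    (hgσ : MellinConvergent (fun x => (g x : ℂ)) σ) : IsDecayProfile (mulConv f g) where
  measurable := measurable_mulConv hf.measurable hg
  nonneg z hz := setIntegral_nonneg measurableSet_Ioi fun y hy =>
    div_nonneg (mul_nonneg (hf.nonneg _ (div_pos hz hy)) (hg0 y hy)) (le_of_lt hy)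
  antitoneOn z hz z' hz' hzz' := by
    refine setIntegral_mono_on (hf.integrableOn_mulConv hg hσ hfσ hgσ hz')
      (hf.integrableOn_mulConv hg hσ hfσ hgσ hz) measurableSet_Ioi fun y hy => ?_
    have hy : (0 : ℝ) < y := hy
    have := hf.antitoneOn (div_pos hz hy) (div_pos hz' hy)
      (div_le_div_of_nonneg_right hzz' hy.le)
    have := hg0 y hy
    gcongr
  continuousOn := by
    intro z hz
    have hz : (0 : ℝ) < z := hz
    refine ContinuousAt.continuousWithinAt ?_
    obtain ⟨C, -, hC⟩ := hf.exists_le_rpow hσ hfσ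
    have hfm := hf.measurable
    refine continuousAt_of_dominated (F := fun z y => f (z / y) * g y / y)
      (bound := fun y => C * (z / 2) ^ (-σ) * (y ^ (σ - 1) * ‖g y‖))
      (Filter.Eventually.of_forall fun z => Measurable.aestronglyMeasurable (by fun_prop)) ?_
      (integrableOn_rpow_mul hg hgσ _) ?_
    · filter_upwards [lt_mem_nhds (half_lt_self hz)] with z' hz'
      exact (ae_restrict_iff' measurableSet_Ioi).mpr
        (ae_of_all _ fun y hy => hf.norm_mulConv_integrand_le hC (half_pos hz) hz'.le hy)
    · refine (ae_restrict_iff' measurableSet_Ioi).mpr (ae_of_all _ fun y hy => ?_)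
      have hc : ContinuousAt f (z / y) := hf.continuousOn.continuousAt (Ioi_mem_nhds (div_pos hz hy))
      have : ContinuousAt (fun z => f (z / y)) z :=
        ContinuousAt.comp (f := fun z => z / y) hc (by fun_prop)
      exact (this.mul_const _).div_const _

end IsDecayProfile

/-! ### Mellin transforms of the building blocks -/

theorem hasMellin_congr {f g : ℝ → ℝ} {s M : ℂ}
    (hf : HasMellin (fun x => (f x : ℂ)) s M) (h : ∀ x, 0 < x → f x = g x) :
    HasMellin (fun x => (g x : ℂ)) s M := by
  have heq : EqOn (fun t : ℝ => (t : ℂ) ^ (s - 1) • (f t : ℂ))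
      (fun t : ℝ => (t : ℂ) ^ (s - 1) • (g t : ℂ)) (Ioi 0) := fun x hx => by
    simp only [h x hx]
  refine ⟨hf.1.congr_fun heq measurableSet_Ioi, ?_⟩
  rw [← hf.2]
  exact (setIntegral_congr_fun measurableSet_Ioi heq).symm

theorem hasMellin_rpow_mul {f : ℝ → ℝ} {s M : ℂ} (a : ℝ)
    (hf : HasMellin (fun x => (f x : ℂ)) (s + a) M) :
    HasMellin (fun x => ((x ^ a * f x : ℝ) : ℂ)) s M := by
  have heq : EqOn (fun t : ℝ => (t : ℂ) ^ (s - 1) • ((t : ℂ) ^ (a : ℂ) • (f t : ℂ)))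
      (fun t : ℝ => (t : ℂ) ^ (s - 1) • ((t ^ a * f t : ℝ) : ℂ)) (Ioi 0) := fun x hx => by
    simp only [smul_eq_mul, Complex.ofReal_mul, Complex.ofReal_cpow (le_of_lt hx)]
  refine ⟨(MellinConvergent.cpow_smul.mpr hf.1).congr_fun heq measurableSet_Ioi, ?_⟩
  rw [← hf.2, ← mellin_cpow_smul]
  exact (setIntegral_congr_fun measurableSet_Ioi heq).symm

theorem hasMellin_comp_rpow {f : ℝ → ℝ} {s M : ℂ} {a : ℝ} (ha : a ≠ 0)
    (hf : HasMellin (fun x => (f x : ℂ)) (s / a) M) :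
    HasMellin (fun x => (f (x ^ a) : ℂ)) s ((|a|⁻¹ : ℝ) * M) := by
  refine ⟨(MellinConvergent.comp_rpow (f := fun x => (f x : ℂ)) ha).mpr hf.1, ?_⟩
  rw [mellin_comp_rpow (fun x => (f x : ℂ)), hf.2, Complex.real_smul]

theorem hasMellin_const_mul {f : ℝ → ℝ} {s M : ℂ} (c : ℝ)
    (hf : HasMellin (fun x => (f x : ℂ)) s M) :
    HasMellin (fun x => ((c * f x : ℝ) : ℂ)) s (c * M) := by
  have := hasMellin_const_smul hf.1 (c : ℂ)
  rw [hf.2] at this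
  simpa only [smul_eq_mul, Complex.ofReal_mul] using this

theorem hasMellin_exp_neg {s : ℂ} (hs : 0 < s.re) :
    HasMellin (fun x => (Real.exp (-x) : ℂ)) s (Complex.Gamma s) := by
  refine ⟨?_, ?_⟩
  · simpa only [MellinConvergent, smul_eq_mul, mul_comm] using! Complex.GammaIntegral_convergent hs
  · rw [Complex.Gamma_eq_integral hs, Complex.GammaIntegral_eq_mellin]

/-- The function `Γ(a) (1 + x)^{-a}`. -/
noncomputable def betaPrime (a x : ℝ) : ℝ := Real.Gamma a * (1 + x) ^ (-a)

theorem betaPrime_eq_mulConv {a x : ℝ} (ha : 0 < a) (hx : 0 < x) :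
    mulConv (fun t => Real.exp (-t)) (fun y => y ^ (-a) * Real.exp (-y ^ (-1 : ℝ))) x =
      betaPrime a x := by
  have h1 := integral_comp_rpow_Ioi
    (fun t : ℝ => t ^ (a - 1) * Real.exp (-((1 + x) * t))) (p := -1) (by norm_num)
  rw [Real.integral_rpow_mul_exp_neg_mul_Ioi ha (by linarith)] at h1
  rw [betaPrime, Real.rpow_neg (by linarith), ← Real.inv_rpow (by linarith), mul_comm, ← one_div,
    ← h1, mulConv]
  refine setIntegral_congr_fun measurableSet_Ioi fun y hy => ?_
  have hy : (0 : ℝ) < y := hy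
  have e1 : y ^ ((-1 : ℝ) - 1) * (y ^ (-1 : ℝ)) ^ (a - 1) = y ^ (-a) / y := by
    rw [← Real.rpow_mul hy.le, ← Real.rpow_add hy, ← Real.rpow_sub_one hy.ne']
    ring_nf
  have e2 : Real.exp (-(x / y)) * Real.exp (-y ^ (-1 : ℝ)) =
      Real.exp (-((1 + x) * y ^ (-1 : ℝ))) := by
    rw [← Real.exp_add, Real.rpow_neg_one]
    congr 1
    field_simp
    ring
  simp only [smul_eq_mul, abs_neg, abs_one, one_mul]
  calc _ = y ^ (-a) / y * (Real.exp (-(x / y)) * Real.exp (-y ^ (-1 : ℝ))) := by ring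
    _ = _ := by rw [e2, ← e1]; ring

theorem hasMellin_betaPrime {a : ℝ} (ha : 0 < a) {s : ℂ} (hs : 0 < s.re) (hsa : s.re < a) :
    HasMellin (fun x => (betaPrime a x : ℂ)) s (Complex.Gamma s * Complex.Gamma (a - s)) := by
  refine hasMellin_congr (hasMellin_mulConv (by fun_prop) (by fun_prop)
    (hasMellin_exp_neg hs) ?_) fun x hx => betaPrime_eq_mulConv ha hx
  refine hasMellin_rpow_mul (f := fun y => Real.exp (-y ^ (-1 : ℝ))) (-a) ?_
  have h := hasMellin_comp_rpow (f := fun x => Real.exp (-x)) (a := -1) (s := s + (-a : ℝ))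
    (by norm_num) (hasMellin_exp_neg (by
      rw [Complex.div_ofReal_re, Complex.add_re, Complex.ofReal_re]
      linarith))
  convert h using 1
  simp only [abs_neg, abs_one, inv_one, Complex.ofReal_one, one_mul]
  congr 1
  push_cast
  ring

theorem isDecayProfile_betaPrime {a : ℝ} (ha : 0 < a) : IsDecayProfile (betaPrime a) where
  measurable := by unfold betaPrime; fun_prop
  nonneg x hx := mul_nonneg (Real.Gamma_pos_of_pos ha).le (Real.rpow_nonneg (by linarith) _)
  antitoneOn x hx y hy hxy := by
    have hx : (0 : ℝ) < x := hx
    refine mul_le_mul_of_nonneg_left ?_ (Real.Gamma_pos_of_pos ha).le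
    exact Real.rpow_le_rpow_of_nonpos (by linarith) (by linarith) (by linarith)
  continuousOn := by
    unfold betaPrime
    refine continuousOn_const.mul (ContinuousOn.rpow_const (by fun_prop) fun x hx => Or.inl ?_)
    have hx : (0 : ℝ) < x := hx
    linarith

/-- The indicator function of `(0, 1]`. -/
noncomputable def unitIndicator : ℝ → ℝ := (Ioc 0 1).indicator fun _ => 1

theorem measurable_unitIndicator : Measurable unitIndicator :=
  measurable_const.indicator measurableSet_Ioc

theorem hasMellin_unitIndicator {s : ℂ} (hs : 0 < s.re) :
    HasMellin (fun x => (unitIndicator x : ℂ)) s (1 / s) := by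
  have : (fun x => (unitIndicator x : ℂ)) = (Ioc (0 : ℝ) 1).indicator fun _ => 1 := by
    ext x
    by_cases hx : x ∈ Ioc (0 : ℝ) 1 <;> simp [unitIndicator, hx]
  rw [this]
  exact hasMellin_one_Ioc hs

/-- The function `-log y * y ^ p` on `(0, 1]`, extended by `0`. For `p = β / 2` it is, up to a
factor, `y` times the density of the pointing error power. -/
noncomputable def negLogPow (p : ℝ) : ℝ → ℝ := (Ioc 0 1).indicator fun y => y ^ p * -Real.log y

theorem measurable_negLogPow (p : ℝ) : Measurable (negLogPow p) :=
  Measurable.indicator (by fun_prop) measurableSet_Ioc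

theorem negLogPow_nonneg (p x : ℝ) : 0 ≤ negLogPow p x :=
  indicator_nonneg (fun _ hy => mul_nonneg (Real.rpow_nonneg hy.1.le _)
    (neg_nonneg.mpr (Real.log_nonpos hy.1.le hy.2))) x

theorem mulConv_unitIndicator {x : ℝ} (hx : 0 < x) :
    mulConv unitIndicator unitIndicator x = (Ioc 0 1).indicator (fun y => -Real.log y) x := by
  have h : ∀ y ∈ Ioi (0 : ℝ), unitIndicator (x / y) * unitIndicator y / y =
      (Icc x 1).indicator (fun y => y⁻¹) y := by
    intro y hy
    have hy : (0 : ℝ) < y := hy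
    have h1 : x / y ∈ Ioc (0 : ℝ) 1 ↔ x ≤ y := by
      simp [div_pos hx hy, div_le_one hy]
    by_cases hxy : x ≤ y <;> by_cases hy1 : y ≤ 1 <;>
      simp [unitIndicator, h1, hxy, hy1, hy, -mem_Ioc, mem_Ioc (x := y)]
  rw [mulConv, setIntegral_congr_fun measurableSet_Ioi h, integral_indicator measurableSet_Icc,
    Measure.restrict_restrict measurableSet_Icc,
    inter_eq_left.mpr (show Icc x 1 ⊆ Ioi 0 from fun y hy => hx.trans_le hy.1)]
  by_cases hx1 : x ≤ 1
  · rw [integral_Icc_eq_integral_Ioc, ← intervalIntegral.integral_of_le hx1,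
      integral_inv_of_pos hx one_pos, indicator_of_mem (by exact ⟨hx, hx1⟩), one_div, Real.log_inv]
  · rw [Icc_eq_empty (by simpa using hx1), indicator_of_notMem (by simp [hx1])]
    simp

theorem hasMellin_negLogPow (p : ℝ) {s : ℂ} (hs : 0 < s.re + p) :
    HasMellin (fun x => (negLogPow p x : ℂ)) s (1 / (s + p) ^ 2) := by
  have hs' : 0 < (s + p).re := by simpa using hs
  have h := hasMellin_rpow_mul p (hasMellin_mulConv measurable_unitIndicator
    measurable_unitIndicator (hasMellin_unitIndicator hs') (hasMellin_unitIndicator hs'))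
  rw [div_mul_div_comm, one_mul, ← sq] at h
  refine hasMellin_congr h fun x hx => ?_
  rw [mulConv_unitIndicator hx]
  by_cases hx1 : x ∈ Ioc (0 : ℝ) 1 <;> simp [negLogPow, hx1]

/-- `log (1 + 1 / x) = ∫ y in 0..1, dy / (x + y)`. -/
theorem mulConv_betaPrime_one {x : ℝ} (hx : 0 < x) :
    mulConv (betaPrime 1) unitIndicator x = Real.log (1 + x⁻¹) := by
  have h : ∀ y ∈ Ioi (0 : ℝ), betaPrime 1 (x / y) * unitIndicator y / y =
      (Ioc 0 1).indicator (fun y => (y + x)⁻¹) y := by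
    intro y hy
    have hy : (0 : ℝ) < y := hy
    by_cases hy1 : y ∈ Ioc (0 : ℝ) 1
    · simp only [betaPrime, unitIndicator, indicator_of_mem hy1, Real.Gamma_one, Real.rpow_neg_one]
      field_simp
    · simp [unitIndicator, hy1]
  rw [mulConv, setIntegral_congr_fun measurableSet_Ioi h, integral_indicator measurableSet_Ioc,
    Measure.restrict_restrict measurableSet_Ioc, inter_eq_left.mpr Ioc_subset_Ioi_self,
    ← intervalIntegral.integral_of_le zero_le_one,
    intervalIntegral.integral_comp_add_right (fun y => y⁻¹), integral_inv_of_pos (by linarith)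
    (by linarith)]
  congr 1
  field_simp
  ring

theorem hasMellin_log {u : ℂ} (hu : 0 < u.re) (hu1 : u.re < 1) :
    HasMellin (fun x => (Real.log (1 + x⁻¹) : ℂ)) u
      (Complex.Gamma u * Complex.Gamma (1 - u) * (1 / u)) := by
  have h := hasMellin_betaPrime one_pos hu hu1
  rw [Complex.ofReal_one] at h
  exact hasMellin_congr (hasMellin_mulConv (isDecayProfile_betaPrime one_pos).measurable
    measurable_unitIndicator h (hasMellin_unitIndicator hu)) fun x hx => mulConv_betaPrime_one hx

/-- A Mellin transform is bounded on vertical lines. -/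
theorem norm_mellin_le {f : ℝ → ℝ} {s : ℂ} {σ : ℝ} (hs : s.re = σ) :
    ‖mellin (fun x => (f x : ℂ)) s‖ ≤ ∫ x in Ioi (0 : ℝ), x ^ (σ - 1) * ‖f x‖ := by
  refine (norm_integral_le_integral_norm _).trans (le_of_eq ?_)
  refine setIntegral_congr_fun measurableSet_Ioi fun x hx => ?_
  simp only [norm_smul, Complex.norm_real, Complex.norm_cpow_eq_rpow_re_of_pos hx, Complex.sub_re,
    Complex.one_re, hs]

/-! ### The two profiles -/

/-- The profile of the density: the convolution of `betaPrime a` and `α⁻² negLogPow (b / α)`, which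
turns out to be `H^{3,1}_{3,3}` for `a = μ + m` and `b = β - α μ`. -/
noncomputable def densityProfile (a b α : ℝ) : ℝ → ℝ :=
  mulConv (betaPrime a) fun y => (α ^ 2)⁻¹ * negLogPow (b / α) y

/-- The function `γ ↦ log (1 + γ) * γ ^ (α μ / 2 - 1)`, written in the variable `y = γ ^ (-α / 2)`
and multiplied by the Jacobian factor that makes it fit into a multiplicative convolution. -/
noncomputable def logWeight (μ α y : ℝ) : ℝ :=
  2 / α * (y ^ (-μ) * Real.log (1 + (y ^ (2 / α))⁻¹))

/-- The profile of the capacity, which turns out to be `H^{5,2}_{5,5}`. -/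
noncomputable def capacityProfile (μ a b α : ℝ) : ℝ → ℝ :=
  mulConv (densityProfile a b α) (logWeight μ α)

section Profiles

variable {μ a b α : ℝ}

theorem measurable_logWeight : Measurable (logWeight μ α) := by
  unfold logWeight
  fun_prop

theorem logWeight_nonneg (hα : 0 < α) (y : ℝ) (hy : 0 < y) : 0 ≤ logWeight μ α y := by
  have : 0 ≤ (y ^ (2 / α))⁻¹ := inv_nonneg.mpr (Real.rpow_nonneg hy.le _)
  have := Real.log_nonneg (by linarith : (1 : ℝ) ≤ 1 + (y ^ (2 / α))⁻¹)
  have := Real.rpow_nonneg hy.le (-μ)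
  unfold logWeight
  positivity

theorem hasMellin_logWeight (hα : 0 < α) {s : ℂ} (hs : μ < s.re) (hs' : s.re < μ + 2 / α) :
    HasMellin (fun x => (logWeight μ α x : ℂ)) s
      (Complex.Gamma (α / 2 * (s - μ)) * Complex.Gamma (1 - α / 2 * (s - μ)) *
        (1 / (α / 2 * (s - μ)))) := by
  have hre : (α / 2 * (s - μ) : ℂ).re = α / 2 * (s.re - μ) := by
    rw [← Complex.ofReal_ofNat, ← Complex.ofReal_div, Complex.re_ofReal_mul]
    simp
  have h1 := hasMellin_log (u := α / 2 * (s - μ)) (by rw [hre]; nlinarith) (by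
    rw [hre]
    have : α / 2 * (2 / α) = 1 := by field_simp
    nlinarith)
  have hα' : (α : ℂ) ≠ 0 := by exact_mod_cast hα.ne'
  have h2 := hasMellin_comp_rpow (f := fun x => Real.log (1 + x⁻¹)) (a := 2 / α)
    (s := s + (-μ : ℝ)) (by positivity) (M := _) (by
      convert h1 using 1
      push_cast
      field_simp
      ring)
  have h3 := hasMellin_const_mul (2 / α) (hasMellin_rpow_mul (-μ) h2)
  refine (congrArg (HasMellin (fun x => (logWeight μ α x : ℂ)) s) ?_).mp h3
  rw [← mul_assoc, ← Complex.ofReal_mul, abs_of_pos (by positivity : 0 < 2 / α),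
    mul_inv_cancel₀ (by positivity), Complex.ofReal_one, one_mul]

theorem hasMellin_densityProfile (ha : 0 < a) (hα : 0 < α) {s : ℂ} (hs : 0 < s.re)
    (hsa : s.re < a) (hsb : 0 < b + α * s.re) :
    HasMellin (fun x => (densityProfile a b α x : ℂ)) s
      (Complex.Gamma s * Complex.Gamma (a - s) * (1 / (b + α * s) ^ 2)) := by
  refine hasMellin_mulConv (isDecayProfile_betaPrime ha).measurable
    ((measurable_negLogPow _).const_mul _) (hasMellin_betaPrime ha hs hsa) ?_
  have h := hasMellin_const_mul (α ^ 2)⁻¹ (hasMellin_negLogPow (b / α) (s := s) (by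
    have : s.re + b / α = (b + α * s.re) / α := by field_simp; ring
    rw [this]; positivity))
  convert h using 1
  have hα' : (α : ℂ) ≠ 0 := by exact_mod_cast hα.ne'
  push_cast
  rw [one_div, one_div, ← mul_inv, ← mul_pow]
  congr 2
  field_simp
  ring

theorem isDecayProfile_densityProfile (ha : 0 < a) (hα : 0 < α) (hab : 0 < b + α * a) :
    IsDecayProfile (densityProfile a b α) := by
  obtain ⟨σ, hσ0, hσa, hσb⟩ : ∃ σ, 0 < σ ∧ σ < a ∧ 0 < b + α * σ := by
    obtain ⟨σ, h1, h2⟩ := exists_between (max_lt ha (show -b / α < a by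
      rw [div_lt_iff₀ hα]; linarith))
    refine ⟨σ, (le_max_left _ _).trans_lt h1, h2, ?_⟩
    have := (le_max_right _ _).trans_lt h1
    rw [div_lt_iff₀ hα] at this
    linarith
  have hσb' : 0 < σ + b / α := by
    have : σ + b / α = (b + α * σ) / α := by field_simp; ring
    rw [this]; positivity
  refine (isDecayProfile_betaPrime ha).mulConv ((measurable_negLogPow _).const_mul _)
    (fun y _ => mul_nonneg (by positivity) (negLogPow_nonneg _ _)) hσ0
    (hasMellin_betaPrime ha (s := σ) (by simpa) (by simpa)).1
    (hasMellin_const_mul _ (hasMellin_negLogPow (b / α) (s := σ) (by simpa))).1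

theorem hasMellin_capacityProfile (ha : 0 < a) (hα : 0 < α) {s : ℂ} (hs0 : 0 < s.re)
    (hsa : s.re < a) (hsb : 0 < b + α * s.re) (hs : μ < s.re) (hs' : s.re < μ + 2 / α) :
    HasMellin (fun x => (capacityProfile μ a b α x : ℂ)) s
      (Complex.Gamma s * Complex.Gamma (a - s) * (1 / (b + α * s) ^ 2) *
        (Complex.Gamma (α / 2 * (s - μ)) * Complex.Gamma (1 - α / 2 * (s - μ)) *
          (1 / (α / 2 * (s - μ))))) :=
  hasMellin_mulConv (isDecayProfile_densityProfile ha hα (by nlinarith)).measurable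
    measurable_logWeight (hasMellin_densityProfile ha hα hs0 hsa hsb)
    (hasMellin_logWeight hα hs hs')

theorem isDecayProfile_capacityProfile (ha : 0 < a) (hα : 0 < α) {σ : ℝ} (hσ0 : 0 < σ)
    (hσa : σ < a) (hσb : 0 < b + α * σ) (hσ : μ < σ) (hσ' : σ < μ + 2 / α) :
    IsDecayProfile (capacityProfile μ a b α) :=
  (isDecayProfile_densityProfile ha hα (by nlinarith)).mulConv measurable_logWeight
    (logWeight_nonneg hα) hσ0
    (hasMellin_densityProfile ha hα (s := σ) (by simpa) (by simpa) (by simpa)).1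
    (hasMellin_logWeight hα (s := σ) (by simpa) (by simpa)).1

/-- The substitution `γ = y ^ (-2 / α)` in the integrand of the capacity profile. -/
theorem logWeight_integrand_eq (hα : 0 < α) (z : ℝ) (f : ℝ → ℝ) {y : ℝ} (hy : 0 < y) :
    f (z / y) * logWeight μ α y / y =
      (|(-(2 / α))| * y ^ (-(2 / α) - 1)) • (Real.log (1 + y ^ (-(2 / α))) *
        (y ^ (-(2 / α))) ^ (α * μ / 2 - 1) * f (z * (y ^ (-(2 / α))) ^ (α / 2))) := by
  have e1 : (y ^ (-(2 / α))) ^ (α / 2) = y⁻¹ := by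
    rw [← Real.rpow_mul hy.le, ← Real.rpow_neg_one]
    congr 1
    field_simp
  have e2 : y ^ (-(2 / α) - 1) * (y ^ (-(2 / α))) ^ (α * μ / 2 - 1) = y ^ (-μ) / y := by
    rw [← Real.rpow_mul hy.le, ← Real.rpow_add hy, ← Real.rpow_sub_one hy.ne']
    congr 1
    field_simp
    ring
  simp only [logWeight, smul_eq_mul, abs_neg, abs_of_pos (show 0 < 2 / α by positivity)]
  rw [e1, ← Real.rpow_neg hy.le]
  calc _ = 2 / α * (y ^ (-μ) / y) * Real.log (1 + y ^ (-(2 / α))) * f (z * y⁻¹) := by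
        rw [div_eq_mul_inv z]; ring
    _ = _ := by rw [← e2]; ring

/-- The integral that defines the capacity profile, in the original variable. -/
theorem capacityProfile_eq (hα : 0 < α) (z : ℝ) :
    capacityProfile μ a b α z = ∫ γ in Ioi (0 : ℝ),
      Real.log (1 + γ) * γ ^ (α * μ / 2 - 1) * densityProfile a b α (z * γ ^ (α / 2)) := by
  rw [← integral_comp_rpow_Ioi _ (neg_ne_zero.mpr (show 2 / α ≠ 0 by positivity))]
  exact setIntegral_congr_fun measurableSet_Ioi fun y hy => logWeight_integrand_eq hα z _ hy

theorem integrableOn_log_mul_densityProfile (ha : 0 < a) (hα : 0 < α) {σ : ℝ} (hσ0 : 0 < σ)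
    (hσa : σ < a) (hσb : 0 < b + α * σ) (hσ : μ < σ) (hσ' : σ < μ + 2 / α) {z : ℝ} (hz : 0 < z) :
    IntegrableOn (fun γ : ℝ =>
      Real.log (1 + γ) * γ ^ (α * μ / 2 - 1) * densityProfile a b α (z * γ ^ (α / 2)))
      (Ioi 0) := by
  have h := (isDecayProfile_densityProfile (b := b) ha hα (by nlinarith)).integrableOn_mulConv
    (measurable_logWeight (μ := μ) (α := α)) hσ0
    (hasMellin_densityProfile ha hα (s := σ) (by simpa) (by simpa) (by simpa)).1
    (hasMellin_logWeight hα (s := σ) (by simpa) (by simpa)).1 hz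
  rw [← integrableOn_Ioi_comp_rpow_iff _ (neg_ne_zero.mpr (show 2 / α ≠ 0 by positivity))]
  exact h.congr_fun (fun y hy => logWeight_integrand_eq hα z _ hy) measurableSet_Ioi

end Profiles

/-! ### Fox H-functions as inverse Mellin transforms -/

theorem continuous_vertical_cpow {z : ℝ} (hz : 0 < z) (c : ℝ) :
    Continuous fun t : ℝ => (z : ℂ) ^ (-((c : ℂ) + t * Complex.I)) := by
  have hz' : (z : ℂ) ≠ 0 := by exact_mod_cast hz.ne'
  exact Continuous.const_cpow (by fun_prop) (Or.inl hz')

/-- If the kernel is, on every separating line, integrable and the Mellin transform of one and the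
same continuous function `f`, then `f` is the H-function, by Mellin inversion. In particular the
integral does not depend on the line. -/
theorem foxH_eq_of_hasMellin {p q : ℕ} {m n : ℕ} {a : Fin p → ℂ × ℝ} {b : Fin q → ℂ × ℝ}
    {f : ℝ → ℝ} (hf : ContinuousOn f (Ioi 0)) (hex : ∃ c, FoxHSeparates m n a b c)
    (hmel : ∀ c, FoxHSeparates m n a b c → ∀ t : ℝ,
      HasMellin (fun x => (f x : ℂ)) (c + t * Complex.I) (foxHKernel m n a b (c + t * Complex.I)))
    (hint : ∀ c, FoxHSeparates m n a b c →
      Integrable fun t : ℝ => foxHKernel m n a b (c + t * Complex.I)) {z : ℝ} (hz : 0 < z) :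
    FoxHWellDefined m n a b z ∧ foxH m n a b z = f z := by
  have hline : ∀ c, FoxHSeparates m n a b c → foxHLine m n a b c z = f z := by
    intro c hc
    have hV : Complex.VerticalIntegrable (mellin fun x => (f x : ℂ)) c := by
      refine (hint c hc).congr (ae_of_all _ fun t => ?_)
      exact (hmel c hc t).2.symm
    have hconv : MellinConvergent (fun x => (f x : ℂ)) c := by
      simpa using (hmel c hc 0).1
    have hcont : ContinuousAt (fun x => (f x : ℂ)) z :=
      Complex.continuous_ofReal.continuousAt.comp (hf.continuousAt (Ioi_mem_nhds hz))
    rw [← mellinInv_mellin_eq c (fun x => (f x : ℂ)) hz hconv hV hcont, mellinInv, foxHLine,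
      Complex.real_smul]
    congr 1
    · push_cast
      ring
    · refine integral_congr_ae (ae_of_all _ fun t => ?_)
      simp only [foxHIntegrand, smul_eq_mul, (hmel c hc t).2]
      rw [mul_comm]
  have hH : foxH m n a b z = f z := by
    rw [foxH, dif_pos hex]
    exact hline _ hex.choose_spec
  refine ⟨⟨hex, fun c hc => ⟨?_, by rw [hline c hc, hH]⟩⟩, hH⟩
  refine (hint c hc).mul_bdd (c := z ^ (-c))
    (continuous_vertical_cpow hz c).aestronglyMeasurable (ae_of_all _ fun t => le_of_eq ?_)
  rw [Complex.norm_cpow_eq_rpow_re_of_pos hz]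
  simp

theorem continuous_Gamma_vertical {l : ℝ → ℂ} (hl : Continuous l) (h : ∀ t, 0 < (l t).re) :
    Continuous fun t => Complex.Gamma (l t) := by
  refine continuous_iff_continuousAt.mpr fun t => ?_
  refine ContinuousAt.comp (f := l) ?_ hl.continuousAt
  refine (Complex.differentiableAt_Gamma _ fun k hk => ?_).continuousAt
  have := h t
  rw [hk] at this
  simp only [Complex.neg_re, Complex.natCast_re] at this
  have : (0 : ℝ) ≤ k := k.cast_nonneg
  linarith

section Lines

variable {μ a b α c : ℝ}

theorem re_vertical (c t : ℝ) : ((c : ℂ) + t * Complex.I).re = c := by simp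

theorem norm_inv_sq (hb : 0 < b + α * c) (t : ℝ) :
    ‖1 / ((b : ℂ) + α * (c + t * Complex.I)) ^ 2‖ =
      ((b + α * c) ^ 2)⁻¹ * (1 + (t * (α / (b + α * c))) ^ 2)⁻¹ := by
  have h : (b : ℂ) + α * (c + t * Complex.I) =
      ((b + α * c : ℝ) : ℂ) + ((α * t : ℝ) : ℂ) * Complex.I := by
    push_cast
    ring
  rw [norm_div, norm_one, norm_pow, h, ← Complex.normSq_eq_norm_sq, Complex.normSq_add_mul_I,
    one_div, ← mul_inv]
  congr 1
  field_simp

theorem integrable_norm_inv_sq (hα : 0 < α) (hb : 0 < b + α * c) :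
    Integrable fun t : ℝ => ((b + α * c) ^ 2)⁻¹ * (1 + (t * (α / (b + α * c))) ^ 2)⁻¹ :=
  (integrable_inv_one_add_sq.comp_mul_right' (by positivity)).const_mul _

theorem integrable_inv_sq (hα : 0 < α) (hb : 0 < b + α * c) :
    Integrable fun t : ℝ => 1 / ((b : ℂ) + α * (c + t * Complex.I)) ^ 2 := by
  refine (integrable_norm_inv_sq hα hb).mono' (Measurable.aestronglyMeasurable (by fun_prop))
    (ae_of_all _ fun t => (norm_inv_sq hb t).le)

/-- The Mellin transform of `densityProfile` is integrable on vertical lines: the Gamma factors are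
bounded there, and the remaining factor is `O(t ^ (-2))`. -/
theorem integrable_densityKernel (hα : 0 < α) (hc : 0 < c) (hca : c < a) (hb : 0 < b + α * c) :
    Integrable fun t : ℝ => Complex.Gamma (c + t * Complex.I) *
      Complex.Gamma (a - (c + t * Complex.I)) * (1 / (b + α * (c + t * Complex.I)) ^ 2) := by
  refine (integrable_inv_sq hα hb).bdd_mul
    (c := ∫ x in Ioi (0 : ℝ), x ^ (c - 1) * ‖betaPrime a x‖) ?_ (ae_of_all _ fun t => ?_)
  · exact ((continuous_Gamma_vertical (by fun_prop) (by simpa)).mul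
      (continuous_Gamma_vertical (by fun_prop) (by simpa))).aestronglyMeasurable
  · rw [← (hasMellin_betaPrime (hc.trans hca) (s := c + t * Complex.I) (by simpa) (by simpa)).2]
    exact norm_mellin_le (re_vertical c t)

theorem integrable_capacityKernel (hα : 0 < α) (hc : 0 < c) (hca : c < a) (hb : 0 < b + α * c)
    (hμc : μ < c) (hcμ : c < μ + 2 / α) :
    Integrable fun t : ℝ => Complex.Gamma (c + t * Complex.I) *
      Complex.Gamma (a - (c + t * Complex.I)) * (1 / (b + α * (c + t * Complex.I)) ^ 2) *
        (Complex.Gamma (α / 2 * (c + t * Complex.I - μ)) *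
          Complex.Gamma (1 - α / 2 * (c + t * Complex.I - μ)) *
            (1 / (α / 2 * (c + t * Complex.I - μ)))) := by
  have hre : ∀ t : ℝ, (α / 2 * (c + t * Complex.I - μ) : ℂ).re = α / 2 * (c - μ) := fun t => by
    rw [← Complex.ofReal_ofNat, ← Complex.ofReal_div, Complex.re_ofReal_mul]
    simp
  have hpos : 0 < α / 2 * (c - μ) := by
    have : 0 < c - μ := by linarith
    positivity
  have hlt : α / 2 * (c - μ) < 1 := by
    have h1 : α / 2 * (2 / α) = 1 := by field_simp
    rw [← h1]
    gcongr
    linarith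
  refine (integrable_densityKernel hα hc hca hb).mul_bdd
    (c := ∫ x in Ioi (0 : ℝ), x ^ (c - 1) * ‖logWeight μ α x‖) ?_ (ae_of_all _ fun t => ?_)
  · refine Continuous.aestronglyMeasurable (((continuous_Gamma_vertical (by fun_prop) fun t => ?_).mul
      (continuous_Gamma_vertical (by fun_prop) fun t => ?_)).mul
      (Continuous.div (by fun_prop) (by fun_prop) fun t h0 => ?_))
    · rw [hre]; exact hpos
    · rw [Complex.sub_re, hre, Complex.one_re]; linarith
    · have := hre t
      rw [h0, Complex.zero_re] at this
      exact hpos.ne this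
  · rw [← (hasMellin_logWeight hα (s := c + t * Complex.I) (by simpa) (by simpa)).2]
    exact norm_mellin_le (re_vertical c t)

end Lines

/-- The double Gamma factors of the kernels reduce to a rational function. -/
theorem Gamma_ratio_sq {w : ℂ} (hw : 0 < w.re) :
    Complex.Gamma w * Complex.Gamma w *
      ((Complex.Gamma (1 + w))⁻¹ * (Complex.Gamma (1 + w))⁻¹) = 1 / w ^ 2 := by
  have hw0 : w ≠ 0 := by
    rintro rfl
    simp at hw
  rw [add_comm, Complex.Gamma_add_one _ hw0]
  have := Complex.Gamma_ne_zero_of_re_pos hw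
  field_simp

theorem forall_left_pole_iff (x : ℝ) {B : ℝ} (hB : 0 < B) (c : ℝ) :
    (∀ k : ℕ, (-((x : ℂ) + k) / (B : ℂ)).re < c) ↔ 0 < x + B * c := by
  have h : ∀ k : ℕ, (-((x : ℂ) + k) / (B : ℂ)).re < c ↔ 0 < x + k + B * c := fun k => by
    rw [Complex.div_ofReal_re, div_lt_iff₀ hB]
    simp only [Complex.neg_re, Complex.add_re, Complex.ofReal_re, Complex.natCast_re]
    constructor <;> intro _ <;> linarith
  simp only [h]
  refine ⟨fun hk => by simpa using hk 0, fun h0 k => ?_⟩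
  have : (0 : ℝ) ≤ k := k.cast_nonneg
  linarith

theorem forall_right_pole_iff (x : ℝ) {B : ℝ} (hB : 0 < B) (c : ℝ) :
    (∀ k : ℕ, c < ((1 - (x : ℂ) + k) / (B : ℂ)).re) ↔ B * c < 1 - x := by
  have h : ∀ k : ℕ, c < ((1 - (x : ℂ) + k) / (B : ℂ)).re ↔ B * c < 1 - x + k := fun k => by
    rw [Complex.div_ofReal_re, lt_div_iff₀ hB]
    simp only [Complex.sub_re, Complex.one_re, Complex.add_re, Complex.ofReal_re,
      Complex.natCast_re, mul_comm]
  simp only [h]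
  refine ⟨fun hk => by simpa using hk 0, fun h0 k => ?_⟩
  have : (0 : ℝ) ≤ k := k.cast_nonneg
  linarith

namespace Params

variable (P : Params)

theorem foxHKernel_pdf {s : ℂ} (hs : 0 < P.β - P.α * P.μ + P.α * s.re) :
    foxHKernel 3 1 P.pdfUpper P.pdfLower s =
      Complex.Gamma s * Complex.Gamma ((P.μ + P.m : ℝ) - s) *
        (1 / ((P.β - P.α * P.μ : ℝ) + P.α * s) ^ 2) := by
  rw [← Gamma_ratio_sq (w := (P.β - P.α * P.μ : ℝ) + P.α * s) (by simpa using hs)]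
  simp only [foxHKernel, pdfUpper, pdfLower, Fin.prod_univ_three]
  simp
  ring_nf

theorem foxHKernel_cap {s : ℂ} (hs : 0 < P.β - P.α * P.μ + P.α * s.re) (hα : 0 < P.α)
    (hμs : P.μ < s.re) :
    foxHKernel 5 2 P.capUpper P.capLower s =
      Complex.Gamma s * Complex.Gamma ((P.μ + P.m : ℝ) - s) *
        (1 / ((P.β - P.α * P.μ : ℝ) + P.α * s) ^ 2) *
        (Complex.Gamma (P.α / 2 * (s - P.μ)) * Complex.Gamma (1 - P.α / 2 * (s - P.μ)) *
            (1 / (P.α / 2 * (s - P.μ)))) := by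
  rw [← Gamma_ratio_sq (w := (P.β - P.α * P.μ : ℝ) + P.α * s) (by simpa using hs)]
  have hre : (P.α / 2 * (s - P.μ) : ℂ).re = P.α / 2 * (s.re - P.μ) := by
    rw [← Complex.ofReal_ofNat, ← Complex.ofReal_div, Complex.re_ofReal_mul]
    simp
  have hpos : 0 < (P.α / 2 * (s - P.μ) : ℂ).re := by
    have : 0 < s.re - P.μ := by linarith
    rw [hre]; positivity
  have hu0 : (P.α / 2 * (s - P.μ) : ℂ) ≠ 0 := by
    intro h
    rw [h] at hpos
    simp at hpos
  have hG : (1 / (P.α / 2 * (s - P.μ)) : ℂ) = Complex.Gamma (P.α / 2 * (s - P.μ)) *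
      (Complex.Gamma (1 + P.α / 2 * (s - P.μ)))⁻¹ := by
    rw [add_comm, Complex.Gamma_add_one _ hu0]
    rw [mul_inv, mul_comm _ (Complex.Gamma _)⁻¹, ← mul_assoc,
      mul_inv_cancel₀ (Complex.Gamma_ne_zero_of_re_pos hpos), one_mul, one_div]
  rw [hG]
  simp only [foxHKernel, capUpper, capLower, Fin.prod_univ_five]
  simp
  ring_nf

theorem separates_pdf_iff (hα : 0 < P.α) (c : ℝ) :
    FoxHSeparates 3 1 P.pdfUpper P.pdfLower c ↔
      0 < c ∧ 0 < P.β - P.α * P.μ + P.α * c ∧ c < P.μ + P.m := by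
  have hU : P.pdfUpper 0 = (((1 - P.μ - P.m : ℝ) : ℂ), 1) := by simp [pdfUpper]
  have hL0 : P.pdfLower 0 = (((0 : ℝ) : ℂ), 1) := by simp [pdfLower]
  have hL1 : P.pdfLower 1 = (((P.β - P.α * P.μ : ℝ) : ℂ), P.α) := by simp [pdfLower]
  have hL2 : P.pdfLower 2 = P.pdfLower 1 := rfl
  simp only [FoxHSeparates, Fin.forall_fin_succ (n := 2), Fin.forall_fin_two, Fin.succ_zero_eq_one,
    Fin.succ_one_eq_two, hL2, hL1, hL0, hU, forall_left_pole_iff _ hα, forall_left_pole_iff _ one_pos,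
    forall_right_pole_iff _ one_pos]
  norm_num
  rw [and_assoc, show 1 - (1 - P.μ - P.m) = P.μ + P.m by ring]

theorem separates_cap_iff (hα : 0 < P.α) (c : ℝ) :
    FoxHSeparates 5 2 P.capUpper P.capLower c ↔
      0 < c ∧ 0 < P.β - P.α * P.μ + P.α * c ∧ c < P.μ + P.m ∧ P.μ < c ∧ c < P.μ + 2 / P.α := by
  have hU0 : P.capUpper 0 = (((1 - P.μ - P.m : ℝ) : ℂ), 1) := by simp [capUpper]
  have hU1 : P.capUpper 1 = (((-(P.α * P.μ / 2) : ℝ) : ℂ), P.α / 2) := by simp [capUpper]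
  have hL0 : P.capLower 0 = (((0 : ℝ) : ℂ), 1) := by simp [capLower]
  have hL1 : P.capLower 1 = (((P.β - P.α * P.μ : ℝ) : ℂ), P.α) := by simp [capLower]
  have hL2 : P.capLower 2 = P.capLower 1 := rfl
  have hL3 : P.capLower 3 = (((-(P.α * P.μ / 2) : ℝ) : ℂ), P.α / 2) := by simp [capLower]
  have hL4 : P.capLower 4 = P.capLower 3 := rfl
  have h5 : ∀ p : Fin 5 → Prop, (∀ j, p j) ↔ p 0 ∧ p 1 ∧ p 2 ∧ p 3 ∧ p 4 := fun p => by
    simp only [Fin.forall_fin_succ (n := 4), Fin.forall_fin_succ (n := 3),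
      Fin.forall_fin_succ (n := 2), Fin.forall_fin_two]
    rfl
  have hα2 : 0 < P.α / 2 := by positivity
  simp only [FoxHSeparates, h5, hL4, hL3, hL2, hL1, hL0, hU1, hU0, forall_left_pole_iff _ hα,
    forall_left_pole_iff _ one_pos, forall_left_pole_iff _ hα2, forall_right_pole_iff _ one_pos,
    forall_right_pole_iff _ hα2]
  have e1 : 0 < -(P.α * P.μ / 2) + P.α / 2 * c ↔ P.μ < c := by
    rw [show -(P.α * P.μ / 2) + P.α / 2 * c = P.α / 2 * (c - P.μ) by ring,
      mul_pos_iff_of_pos_left hα2, sub_pos]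
  have e2 : P.α / 2 * c < 1 - -(P.α * P.μ / 2) ↔ c < P.μ + 2 / P.α := by
    rw [show 1 - -(P.α * P.μ / 2) = P.α / 2 * (P.μ + 2 / P.α) by field_simp; ring,
      mul_lt_mul_iff_right₀ hα2]
  rw [e1, e2, show 1 - (1 - P.μ - P.m) = P.μ + P.m by ring]
  norm_num
  tauto

/-- The H-function of the density is `densityProfile`. -/
theorem foxH_pdf (hα : 0 < P.α) (hμ : 0 < P.μ) (hm : 0 < P.m) (hβ : 0 < P.β) {z : ℝ} (hz : 0 < z) :
    FoxHWellDefined 3 1 P.pdfUpper P.pdfLower z ∧ foxH 3 1 P.pdfUpper P.pdfLower z =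
      densityProfile (P.μ + P.m) (P.β - P.α * P.μ) P.α z := by
  have ha : 0 < P.μ + P.m := by positivity
  have hre := fun c t : ℝ => re_vertical c t
  refine foxH_eq_of_hasMellin (isDecayProfile_densityProfile ha hα ?_).continuousOn ?_ ?_ ?_ hz
  · have := mul_pos hα hm
    nlinarith
  · obtain ⟨c, h1, h2⟩ := exists_between (lt_add_of_pos_right P.μ hm)
    refine ⟨c, (P.separates_pdf_iff hα c).mpr ⟨hμ.trans h1, ?_, h2⟩⟩
    nlinarith
  · intro c hc t
    obtain ⟨h0, hb, hca⟩ := (P.separates_pdf_iff hα c).mp hc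
    rw [P.foxHKernel_pdf (by rwa [hre])]
    exact hasMellin_densityProfile ha hα (by rwa [hre]) (by rwa [hre]) (by rwa [hre])
  · intro c hc
    obtain ⟨h0, hb, hca⟩ := (P.separates_pdf_iff hα c).mp hc
    refine (integrable_densityKernel hα h0 hca hb).congr (ae_of_all _ fun t => ?_)
    exact (P.foxHKernel_pdf (by rwa [hre])).symm

/-- The numbers slightly to the right of `μ` are real parts of lines that separate the poles of the
kernels of both H-functions. -/
theorem exists_exponent (hα : 0 < P.α) (hμ : 0 < P.μ) (hm : 0 < P.m) (hβ : 0 < P.β) {ε : ℝ}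
    (hε : 0 < ε) : ∃ c, 0 < c ∧ 0 < P.β - P.α * P.μ + P.α * c ∧ c < P.μ + P.m ∧ P.μ < c ∧
      c < P.μ + 2 / P.α ∧ c < P.μ + ε := by
  have h : P.μ < P.μ + min (min P.m (2 / P.α)) ε :=
    lt_add_of_pos_right _ (lt_min (lt_min hm (by positivity)) hε)
  obtain ⟨c, h1, h2⟩ := exists_between h
  have h3 := min_le_left (min P.m (2 / P.α)) ε
  have h4 := min_le_right (min P.m (2 / P.α)) ε
  have h5 := min_le_left P.m (2 / P.α)
  have h6 := min_le_right P.m (2 / P.α)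
  refine ⟨c, hμ.trans h1, ?_, by linarith, h1, by linarith, by linarith⟩
  nlinarith

/-- The H-function of the capacity is `capacityProfile`. -/
theorem foxH_cap (hα : 0 < P.α) (hμ : 0 < P.μ) (hm : 0 < P.m) (hβ : 0 < P.β) {z : ℝ} (hz : 0 < z) :
    FoxHWellDefined 5 2 P.capUpper P.capLower z ∧ foxH 5 2 P.capUpper P.capLower z =
      capacityProfile P.μ (P.μ + P.m) (P.β - P.α * P.μ) P.α z := by
  have ha : 0 < P.μ + P.m := by positivity
  have hre := fun c t : ℝ => re_vertical c t
  obtain ⟨c, h1, h2, h3, h4, h5, -⟩ := P.exists_exponent hα hμ hm hβ one_pos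
  refine foxH_eq_of_hasMellin (isDecayProfile_capacityProfile ha hα h1 h3 h2 h4 h5).continuousOn
    ⟨c, (P.separates_cap_iff hα c).mpr ⟨h1, h2, h3, h4, h5⟩⟩ ?_ ?_ hz
  · intro c hc t
    obtain ⟨h0, hb, hca, hμc, hcμ⟩ := (P.separates_cap_iff hα c).mp hc
    rw [P.foxHKernel_cap (by rwa [hre]) hα (by rwa [hre])]
    exact hasMellin_capacityProfile ha hα (by rwa [hre]) (by rwa [hre]) (by rwa [hre])
      (by rwa [hre]) (by rwa [hre])
  · intro c hc
    obtain ⟨h0, hb, hca, hμc, hcμ⟩ := (P.separates_cap_iff hα c).mp hc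
    refine (integrable_capacityKernel hα h0 hca hb hμc hcμ).congr (ae_of_all _ fun t => ?_)
    exact (P.foxHKernel_cap (by rwa [hre]) hα (by rwa [hre])).symm

end Params

/-! ### The capacity integral of the quadrature density -/

namespace Params

/-- The sign conditions on the parameters of the channel. -/
structure IsAdmissible (P : Params) : Prop where
  α_pos : 0 < P.α
  μ_pos : 0 < P.μ
  one_lt_m : 1 < P.m
  β_pos : 0 < P.β
  lam_pos : 0 < P.lam
  δ_pos : 0 < P.δ
  κ_nonneg : 0 ≤ P.κ
  γ₀_pos : 0 < P.γ₀
  d₀_pos : 0 < P.d₀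
  R_pos : 0 < P.R

/-- `H^{3,1}_{3,3}` as a real function. -/
noncomputable def densityH (P : Params) : ℝ → ℝ :=
  densityProfile (P.μ + P.m) (P.β - P.α * P.μ) P.α

/-- `H^{5,2}_{5,5}` as a real function. -/
noncomputable def capacityH (P : Params) : ℝ → ℝ :=
  capacityProfile P.μ (P.μ + P.m) (P.β - P.α * P.μ) P.α

variable {P : Params}

/-- The coefficient of the quadrature node `x` in the term of index `i`. -/
noncomputable def nodeCoeff (P : Params) (N : ℕ) (i : Fin P.l) (x : ℝ) : ℝ :=
  P.B i * (P.d₀ / P.R) ^ (P.b i + 1) * glWeight N x * P.Phi₁ i x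

/-- The integrand of `capacityH`, rescaled by `γ ↦ γ / g`. -/
theorem log_mul_rpow_mul_densityH_eq {g w : ℝ} (hg : 0 < g) {γ : ℝ}
    (hγ : 0 < γ) :
    Real.log (1 + γ) * ((γ / g) ^ (P.α * P.μ / 2 - 1) * P.densityH (w * (γ / g) ^ (P.α / 2))) =
      g ^ (1 - P.α * P.μ / 2) * (Real.log (1 + γ) * γ ^ (P.α * P.μ / 2 - 1) *
        P.densityH (w / g ^ (P.α / 2) * γ ^ (P.α / 2))) := by
  rw [Real.div_rpow hγ.le hg.le, Real.div_rpow hγ.le hg.le,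
    show 1 - P.α * P.μ / 2 = -(P.α * P.μ / 2 - 1) by ring, Real.rpow_neg hg.le,
    div_mul_comm w, mul_comm (γ ^ (P.α / 2) / _), div_eq_mul_inv (γ ^ (P.α * P.μ / 2 - 1))]
  ring

namespace IsAdmissible

theorem m_pos (hP : P.IsAdmissible) : 0 < P.m := zero_lt_one.trans hP.one_lt_m

theorem a_pos (hP : P.IsAdmissible) : 0 < P.μ + P.m := add_pos hP.μ_pos hP.m_pos

theorem c₂_pos (hP : P.IsAdmissible) : 0 < P.c₂ := by
  have h1 := hP.α_pos
  have h2 := hP.μ_pos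
  have h3 := sub_pos.mpr hP.one_lt_m
  have h4 := hP.β_pos
  have h5 := hP.lam_pos
  unfold c₂
  positivity

theorem isDecayProfile_densityH (hP : P.IsAdmissible) : IsDecayProfile P.densityH :=
  isDecayProfile_densityProfile hP.a_pos hP.α_pos (by
    have := mul_pos hP.α_pos hP.m_pos
    have := hP.β_pos
    nlinarith)

theorem isDecayProfile_capacityH (hP : P.IsAdmissible) : IsDecayProfile P.capacityH := by
  obtain ⟨c, h1, h2, h3, h4, h5, -⟩ :=
    P.exists_exponent hP.α_pos hP.μ_pos hP.m_pos hP.β_pos one_pos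
  exact isDecayProfile_capacityProfile hP.a_pos hP.α_pos h1 h3 h2 h4 h5

/-- `capacityH` grows at `0` more slowly than any power `z ^ (-(μ + ε))`. -/
theorem exists_capacityH_le (hP : P.IsAdmissible) {ε : ℝ} (hε : 0 < ε) :
    ∃ c C, P.μ < c ∧ c < P.μ + ε ∧ 0 ≤ C ∧ ∀ z, 0 < z → P.capacityH z ≤ C * z ^ (-c) := by
  obtain ⟨c, h1, h2, h3, h4, h5, h6⟩ :=
    P.exists_exponent hP.α_pos hP.μ_pos hP.m_pos hP.β_pos hε
  obtain ⟨C, hC0, hC⟩ := hP.isDecayProfile_capacityH.exists_le_rpow h1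
    (hasMellin_capacityProfile hP.a_pos hP.α_pos (s := c) (by simpa) (by simpa) (by simpa)
      (by simpa) (by simpa)).1
  exact ⟨c, C, h4, h6, hC0, hC⟩

theorem integrableOn_log_mul_densityH (hP : P.IsAdmissible) {g w : ℝ} (hg : 0 < g) (hw : 0 < w) :
    IntegrableOn (fun γ : ℝ => Real.log (1 + γ) *
      ((γ / g) ^ (P.α * P.μ / 2 - 1) * P.densityH (w * (γ / g) ^ (P.α / 2)))) (Ioi 0) := by
  obtain ⟨c, h1, h2, h3, h4, h5, -⟩ :=
    P.exists_exponent hP.α_pos hP.μ_pos hP.m_pos hP.β_pos one_pos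
  have h := (integrableOn_log_mul_densityProfile hP.a_pos hP.α_pos h1 h3 h2 h4 h5
    (div_pos hw (Real.rpow_pos_of_pos hg (P.α / 2)))).const_mul (g ^ (1 - P.α * P.μ / 2))
  exact IntegrableOn.congr_fun h (fun γ hγ => (log_mul_rpow_mul_densityH_eq hg hγ).symm)
    measurableSet_Ioi

theorem integral_log_mul_densityH (hP : P.IsAdmissible) {g : ℝ} (hg : 0 < g) (w : ℝ) :
    ∫ γ in Ioi (0 : ℝ), Real.log (1 + γ) *
      ((γ / g) ^ (P.α * P.μ / 2 - 1) * P.densityH (w * (γ / g) ^ (P.α / 2))) =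
      g ^ (1 - P.α * P.μ / 2) * P.capacityH (w / g ^ (P.α / 2)) := by
  rw [setIntegral_congr_fun measurableSet_Ioi
    fun γ hγ => log_mul_rpow_mul_densityH_eq hg hγ, integral_const_mul, capacityH,
    capacityProfile_eq hP.α_pos]
  rfl

theorem Phi₂_pos (hP : P.IsAdmissible) {x : ℝ} (hx : -1 < x) : 0 < P.Phi₂ x := by
  have h1 := hP.R_pos
  have h2 := hP.d₀_pos
  have h3 : 0 < x + 1 := by linarith
  unfold Phi₂ Phi
  positivity

theorem pdfSNRQuadrature_eq (hP : P.IsAdmissible) (N : ℕ) {γ : ℝ} (hγ : 0 < γ) :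
    P.pdfSNRQuadrature N γ =
      ((2 * P.R * P.c₁ * P.c₂ ^ (-(P.μ + P.m)) / (P.d₀ * P.γ₀ * Real.Gamma (P.μ + P.m)) *
        (γ / P.γ₀) ^ (P.α * P.μ / 2 - 1) * ∑ i : Fin P.l, ∑ x ∈ glNodes N, P.nodeCoeff N i x *
          P.densityH (P.Phi₂ x / P.c₂ * (γ / P.γ₀) ^ (P.α / 2)) : ℝ) : ℂ) := by
  rw [pdfSNRQuadrature, Complex.ofReal_mul _ (Finset.sum _ _), Complex.ofReal_sum]
  congr 1
  refine Finset.sum_congr rfl fun i _ => ?_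
  rw [Complex.ofReal_sum]
  refine Finset.sum_congr rfl fun x hx => ?_
  have hz : 0 < P.Phi₂ x / P.c₂ * (γ / P.γ₀) ^ (P.α / 2) :=
    mul_pos (div_pos (hP.Phi₂_pos (mem_Ioo_of_mem_glNodes hx).1) hP.c₂_pos)
      (Real.rpow_pos_of_pos (div_pos hγ hP.γ₀_pos) _)
  rw [(P.foxH_pdf hP.α_pos hP.μ_pos hP.m_pos hP.β_pos hz).2]
  exact (Complex.ofReal_mul _ _).symm

theorem capacityClosedForm_eq (hP : P.IsAdmissible) (N : ℕ) :
    P.capacityClosedForm N =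
      ((2 * P.R * P.c₁ * P.c₂ ^ (-(P.μ + P.m)) / (Real.log 2 * P.d₀ * Real.Gamma (P.μ + P.m)) *
        P.γ₀ ^ (-(P.α * P.μ / 2)) * ∑ i : Fin P.l, ∑ x ∈ glNodes N, P.nodeCoeff N i x *
          P.capacityH (P.Phi₂ x / (P.c₂ * P.γ₀ ^ (P.α / 2))) : ℝ) : ℂ) := by
  rw [capacityClosedForm, Complex.ofReal_mul _ (Finset.sum _ _), Complex.ofReal_sum]
  congr 1
  refine Finset.sum_congr rfl fun i _ => ?_
  rw [Complex.ofReal_sum]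
  refine Finset.sum_congr rfl fun x hx => ?_
  have hz : 0 < P.Phi₂ x / (P.c₂ * P.γ₀ ^ (P.α / 2)) :=
    div_pos (hP.Phi₂_pos (mem_Ioo_of_mem_glNodes hx).1)
      (mul_pos hP.c₂_pos (Real.rpow_pos_of_pos hP.γ₀_pos _))
  rw [(P.foxH_cap hP.α_pos hP.μ_pos hP.m_pos hP.β_pos hz).2]
  exact (Complex.ofReal_mul _ _).symm

theorem log_mul_pdfSNRQuadrature_eq (hP : P.IsAdmissible) (N : ℕ) {γ : ℝ} (hγ : 0 < γ) :
    (Real.log (1 + γ) : ℂ) * P.pdfSNRQuadrature N γ =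
      ((∑ i : Fin P.l, ∑ x ∈ glNodes N,
        2 * P.R * P.c₁ * P.c₂ ^ (-(P.μ + P.m)) / (P.d₀ * P.γ₀ * Real.Gamma (P.μ + P.m)) *
          P.nodeCoeff N i x * (Real.log (1 + γ) * ((γ / P.γ₀) ^ (P.α * P.μ / 2 - 1) *
            P.densityH (P.Phi₂ x / P.c₂ * (γ / P.γ₀) ^ (P.α / 2)))) : ℝ) : ℂ) := by
  rw [hP.pdfSNRQuadrature_eq N hγ, ← Complex.ofReal_mul]
  congr 1
  simp only [Finset.mul_sum]
  refine Finset.sum_congr rfl fun i _ => Finset.sum_congr rfl fun x _ => ?_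
  ring

theorem integrableOn_summand (hP : P.IsAdmissible) (N : ℕ) (i : Fin P.l) {x : ℝ}
    (hx : x ∈ glNodes N) (C : ℝ) :
    IntegrableOn (fun γ : ℝ => C * P.nodeCoeff N i x * (Real.log (1 + γ) *
      ((γ / P.γ₀) ^ (P.α * P.μ / 2 - 1) *
        P.densityH (P.Phi₂ x / P.c₂ * (γ / P.γ₀) ^ (P.α / 2))))) (Ioi 0) :=
  (hP.integrableOn_log_mul_densityH hP.γ₀_pos
    (div_pos (hP.Phi₂_pos (mem_Ioo_of_mem_glNodes hx).1) hP.c₂_pos)).const_mul _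

theorem integrableOn_log_mul_pdfSNRQuadrature (hP : P.IsAdmissible) (N : ℕ) :
    IntegrableOn (fun γ : ℝ => (Real.log (1 + γ) : ℂ) * P.pdfSNRQuadrature N γ) (Ioi 0) := by
  refine IntegrableOn.congr_fun ?_
    (fun γ hγ => (hP.log_mul_pdfSNRQuadrature_eq N hγ).symm) measurableSet_Ioi
  exact Integrable.ofReal (integrable_finsetSum Finset.univ fun i _ =>
    integrable_finsetSum (glNodes N) fun x hx => hP.integrableOn_summand N i hx _)

theorem integral_log_mul_pdfSNRQuadrature (hP : P.IsAdmissible) (N : ℕ) :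
    (1 / Real.log 2 : ℂ) *
        ∫ γ in Ioi (0 : ℝ), (Real.log (1 + γ) : ℂ) * P.pdfSNRQuadrature N γ =
      P.capacityClosedForm N := by
  rw [setIntegral_congr_fun measurableSet_Ioi
    fun γ hγ => hP.log_mul_pdfSNRQuadrature_eq N hγ, integral_complex_ofReal,
    integral_finsetSum Finset.univ fun i _ => integrable_finsetSum (glNodes N) fun x hx =>
      hP.integrableOn_summand N i hx _, hP.capacityClosedForm_eq, ← Complex.ofReal_one,
    ← Complex.ofReal_div, ← Complex.ofReal_mul]
  congr 1
  rw [Finset.mul_sum, Finset.mul_sum]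
  refine Finset.sum_congr rfl fun i _ => ?_
  rw [integral_finsetSum (glNodes N) fun x hx => hP.integrableOn_summand N i hx _, Finset.mul_sum,
    Finset.mul_sum]
  refine Finset.sum_congr rfl fun x _ => ?_
  rw [integral_const_mul, hP.integral_log_mul_densityH hP.γ₀_pos, div_div, sub_eq_add_neg,
    Real.rpow_add hP.γ₀_pos, Real.rpow_one]
  have h1 := hP.γ₀_pos.ne'
  have h2 := hP.d₀_pos.ne'
  have h3 := (Real.log_pos one_lt_two).ne'
  have h4 := (Real.Gamma_pos_of_pos hP.a_pos).ne'
  field_simp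

end IsAdmissible

/-! ### The density of the channel -/

/-- The constant in front of the density of `V`. -/
noncomputable def pdfVConst (P : Params) : ℝ :=
  4 * P.c₁ * P.c₂ ^ (-(P.μ + P.m)) / Real.Gamma (P.μ + P.m)

theorem c₁_eq : P.c₁ = P.β ^ 2 * P.α / (8 * ProbabilityTheory.beta P.μ P.m) * P.c₂ ^ P.m := by
  rw [c₁, c₂]
  congr 3
  ring

theorem continuousOn_gain : ContinuousOn P.gain (Ioi 1) := by
  unfold gain
  refine (continuousOn_const.mul (ContinuousOn.rpow_const (by fun_prop) fun x hx => Or.inl ?_)).mul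
    (by fun_prop)
  have hx : (1 : ℝ) < x := hx
  linarith

theorem measurable_gain : Measurable P.gain := by
  unfold gain
  fun_prop

/-- Up to a constant, the capacity at the distance `d`, weighted by `(d - 1) ^ b`. For `b > 0` the
first factor makes the value at `d = 1` equal to `0`, which is the limit. -/
noncomputable def distTerm (P : Params) (b d : ℝ) : ℝ :=
  (d - 1) ^ b * (P.gain d ^ (-(P.α * P.μ / 2)) * P.capacityH (1 / P.c₂ / P.gain d ^ (P.α / 2)))

/-- The coefficient of `(d - 1) ^ b i` in the density of the distance. -/
noncomputable def distCoeff (P : Params) (i : Fin P.l) : ℝ :=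
  P.B i * (P.d₀ / P.R) ^ (P.b i + 1)

/-- The integrand `log (1 + γ) * condPDF γ d * pdfD d`, for `γ > 0` and `d > 1`. -/
noncomputable def capacityIntegrand (P : Params) (q : ℝ × ℝ) : ℝ :=
  P.pdfVConst / P.gain q.2 * P.pdfD q.2 * (Real.log (1 + q.1) *
    ((q.1 / P.gain q.2) ^ (P.α * P.μ / 2 - 1) *
      P.densityH (1 / P.c₂ * (q.1 / P.gain q.2) ^ (P.α / 2))))

theorem pdfD_mul_eq_sum (d : ℝ) :
    P.pdfD d * (P.gain d ^ (-(P.α * P.μ / 2)) * P.capacityH (1 / P.c₂ / P.gain d ^ (P.α / 2))) =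
      ∑ i, P.distCoeff i * P.distTerm (P.b i) d := by
  rw [pdfD, Finset.sum_mul]
  refine Finset.sum_congr rfl fun i _ => ?_
  rw [distCoeff, distTerm]
  ring

namespace IsAdmissible

theorem scale_eq_c₂ (hP : P.IsAdmissible) :
    (P.m - 1) * P.fadingPower ^ (P.α / 2) / (P.lam ^ (P.α / 2) * P.μ) = P.c₂ := by
  have h1 := hP.β_pos
  have h2 : P.fadingPower ^ (P.α / 2) = (P.β + 2) ^ P.α / P.β ^ P.α := by
    rw [fadingPower, ← Real.rpow_natCast, ← Real.rpow_mul (by positivity),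
      ← Real.div_rpow (by positivity) h1.le]
    congr 1
    push_cast
    ring
  rw [h2, c₂]
  have h3 := (Real.rpow_pos_of_pos h1 P.α).ne'
  have h4 := (Real.rpow_pos_of_pos hP.lam_pos (P.α / 2)).ne'
  have h5 := hP.μ_pos.ne'
  field_simp

/-- The density of `V` is a power of `v` times the multiplicative convolution that defines
`densityH`, after the substitution `t = y ^ (α / 2)`. -/
theorem pdfV_eq (hP : P.IsAdmissible) {v : ℝ} (hv : 0 < v) :
    P.pdfV v = P.pdfVConst *
      (v ^ (P.α * P.μ / 2 - 1) * P.densityH (1 / P.c₂ * v ^ (P.α / 2))) := by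
  have hα := hP.α_pos
  have hc := hP.c₂_pos
  have hB := ProbabilityTheory.beta_pos hP.μ_pos hP.m_pos
  have hG := Real.Gamma_pos_of_pos hP.a_pos
  have hsupp : P.pdfV v = ∫ y in Ioi (0 : ℝ), 1 / |y| * P.pdfX (v / y) * P.pdfZ y := by
    rw [pdfV, setIntegral_eq_integral_of_forall_compl_eq_zero]
    intro y hy
    have : ¬ 0 < y := hy
    simp [pdfZ, this]
  rw [hsupp, densityH, densityProfile, mulConv,
    ← integral_comp_rpow_Ioi (fun t => betaPrime (P.μ + P.m) (1 / P.c₂ * v ^ (P.α / 2) / t) *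
      ((P.α ^ 2)⁻¹ * negLogPow ((P.β - P.α * P.μ) / P.α) t) / t)
      (show P.α / 2 ≠ 0 by positivity), ← mul_assoc, ← integral_const_mul]
  refine setIntegral_congr_fun measurableSet_Ioi fun y hy => ?_
  have hy : (0 : ℝ) < y := hy
  simp only [smul_eq_mul]
  by_cases hy1 : y < 1
  · have hmem : y ^ (P.α / 2) ∈ Ioc (0 : ℝ) 1 :=
      ⟨Real.rpow_pos_of_pos hy _, Real.rpow_le_one hy.le hy1.le (by positivity)⟩
    have hvy : 0 < v / y := div_pos hv hy
    have e1 : (v / y) ^ (P.α / 2) = v ^ (P.α / 2) / y ^ (P.α / 2) := Real.div_rpow hv.le hy.le _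
    have e2 : (v ^ (P.α / 2) / y ^ (P.α / 2) + P.c₂) ^ (-(P.m + P.μ)) =
        P.c₂ ^ (-(P.μ + P.m)) *
          (1 + 1 / P.c₂ * v ^ (P.α / 2) / y ^ (P.α / 2)) ^ (-(P.μ + P.m)) := by
      have h1 := Real.rpow_pos_of_pos hv (P.α / 2)
      have h2 := hmem.1
      rw [← Real.mul_rpow hc.le (by positivity), add_comm P.m]
      congr 1
      field_simp
      ring
    have e3 : (y ^ (P.α / 2)) ^ ((P.β - P.α * P.μ) / P.α) = y ^ ((P.β - P.α * P.μ) / 2) := by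
      rw [← Real.rpow_mul hy.le]
      congr 1
      field_simp
    have e4 : y ^ (P.α / 2 - 1) = y ^ (P.α / 2) / y := Real.rpow_sub_one hy.ne' _
    have e5 : (v / y) ^ (P.α * P.μ / 2 - 1) * y ^ (P.β / 2 - 1) =
        v ^ (P.α * P.μ / 2 - 1) * y ^ ((P.β - P.α * P.μ) / 2) := by
      rw [Real.div_rpow hv.le hy.le, div_mul_eq_mul_div, mul_div_assoc, ← Real.rpow_sub hy]
      congr 2
      ring
    rw [pdfX, if_pos hvy, pdfZ, if_pos ⟨hy, hy1⟩, hP.scale_eq_c₂, e1, e2, negLogPow,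
      indicator_of_mem hmem, e3, e4, Real.log_rpow hy, betaPrime, pdfVConst, c₁_eq, abs_of_pos hy,
      abs_of_pos (by positivity : 0 < P.α / 2)]
    set Q := (1 + 1 / P.c₂ * v ^ (P.α / 2) / y ^ (P.α / 2)) ^ (-(P.μ + P.m))
    have h2 := hmem.1.ne'
    calc _ = P.α / (2 * ProbabilityTheory.beta P.μ P.m) * P.c₂ ^ P.m *
          (P.c₂ ^ (-(P.μ + P.m)) * Q) * (-(P.β ^ 2 / 4) * Real.log y) / y *
          ((v / y) ^ (P.α * P.μ / 2 - 1) * y ^ (P.β / 2 - 1)) := by ring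
      _ = _ := by
        rw [e5]
        field_simp
        ring
  · have h1 : P.pdfZ y = 0 := by simp [pdfZ, hy1]
    have h2 : negLogPow ((P.β - P.α * P.μ) / P.α) (y ^ (P.α / 2)) = 0 := by
      rcases eq_or_lt_of_le (not_lt.mp hy1) with rfl | hlt
      · simp [negLogPow]
      · have := Real.one_lt_rpow hlt (by positivity : 0 < P.α / 2)
        exact indicator_of_notMem (fun h => absurd h.2 (not_le.mpr this)) _
    rw [h1, h2]
    ring

theorem gain_pos (hP : P.IsAdmissible) {d : ℝ} (hd : 1 < d) : 0 < P.gain d := by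
  have h1 := hP.γ₀_pos
  have h2 : 0 < d - 1 := by linarith
  unfold gain
  positivity

theorem condPDF_eq (hP : P.IsAdmissible) {γ d : ℝ} (hγ : 0 < γ) (hd : 1 < d) :
    P.condPDF γ d = P.pdfVConst / P.gain d * ((γ / P.gain d) ^ (P.α * P.μ / 2 - 1) *
      P.densityH (1 / P.c₂ * (γ / P.gain d) ^ (P.α / 2))) := by
  rw [condPDF, hP.pdfV_eq (div_pos hγ (hP.gain_pos hd))]
  ring

/-! ### The capacity as an integral over the distance -/

/-- Near `d = 1` the term is `O((d - 1) ^ (b - δ α (c - μ) / 2))` for `c` slightly larger than `μ`. -/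
theorem tendsto_distTerm_one (hP : P.IsAdmissible) {b : ℝ} (hb : 0 < b) :
    Filter.Tendsto (P.distTerm b) (nhdsWithin 1 (Ioi 1)) (nhds 0) := by
  have hα := hP.α_pos
  have hδ := hP.δ_pos
  have hγ₀ := hP.γ₀_pos
  have hc₂ := hP.c₂_pos
  -- this choice of `ε` makes the exponent of `d - 1` in the bound below positive
  obtain ⟨c, C, hc, hcε, hC0, hC⟩ := hP.exists_capacityH_le
    (show 0 < 2 * b / (P.δ * P.α) by positivity)
  have hε0 : 0 ≤ P.α * (c - P.μ) / 2 := by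
    have : 0 < c - P.μ := by linarith
    positivity
  have hexp : 0 < b + -P.δ * (P.α * (c - P.μ) / 2) := by
    have h1 : c - P.μ < 2 * b / (P.δ * P.α) := by linarith
    rw [lt_div_iff₀ (by positivity)] at h1
    linarith
  have hbound : ∀ d ∈ Ioi (1 : ℝ), P.distTerm b d ≤
      C * P.c₂ ^ c * P.γ₀ ^ (P.α * (c - P.μ) / 2) *
        (d - 1) ^ (b + -P.δ * (P.α * (c - P.μ) / 2)) := by
    intro d hd
    have hd : (1 : ℝ) < d := hd
    have hd0 : 0 < d - 1 := by linarith
    have hg := hP.gain_pos hd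
    have hgα := Real.rpow_pos_of_pos hg (P.α / 2)
    have h1 := hC (1 / P.c₂ / P.gain d ^ (P.α / 2)) (by positivity)
    have h2 : (1 / P.c₂ / P.gain d ^ (P.α / 2)) ^ (-c) =
        P.c₂ ^ c * P.gain d ^ (P.α / 2 * c) := by
      rw [div_div, Real.rpow_neg (by positivity), ← Real.inv_rpow (by positivity), one_div, inv_inv,
        Real.mul_rpow hc₂.le hgα.le, Real.rpow_mul hg.le]
    have h3 : P.gain d ≤ P.γ₀ * (d - 1) ^ (-P.δ) := by
      unfold gain
      refine mul_le_of_le_one_right (by positivity) (Real.exp_le_one_iff.mpr ?_)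
      have := hP.κ_nonneg
      have := hP.d₀_pos
      have : 0 ≤ P.κ * P.d₀ * d := by positivity
      linarith
    calc P.distTerm b d
        ≤ (d - 1) ^ b * (P.gain d ^ (-(P.α * P.μ / 2)) *
            (C * (P.c₂ ^ c * P.gain d ^ (P.α / 2 * c)))) := by
          rw [h2] at h1
          unfold distTerm
          gcongr
      _ = (d - 1) ^ b * (C * P.c₂ ^ c * P.gain d ^ (P.α * (c - P.μ) / 2)) := by
          rw [show P.α * (c - P.μ) / 2 = -(P.α * P.μ / 2) + P.α / 2 * c by ring, Real.rpow_add hg]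
          ring
      _ ≤ (d - 1) ^ b * (C * P.c₂ ^ c * (P.γ₀ * (d - 1) ^ (-P.δ)) ^ (P.α * (c - P.μ) / 2)) := by
          gcongr
      _ = _ := by
          rw [Real.mul_rpow hγ₀.le (by positivity), ← Real.rpow_mul hd0.le, Real.rpow_add hd0]
          ring
  have hnonneg : ∀ d ∈ Ioi (1 : ℝ), 0 ≤ P.distTerm b d := by
    intro d hd
    have hd : (1 : ℝ) < d := hd
    have hd0 : 0 < d - 1 := by linarith
    have hg := hP.gain_pos hd
    have := hP.isDecayProfile_capacityH.nonneg (1 / P.c₂ / P.gain d ^ (P.α / 2)) (by positivity)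
    unfold distTerm
    positivity
  have hlim : Filter.Tendsto (fun d : ℝ => C * P.c₂ ^ c * P.γ₀ ^ (P.α * (c - P.μ) / 2) *
      (d - 1) ^ (b + -P.δ * (P.α * (c - P.μ) / 2))) (nhdsWithin 1 (Ioi 1)) (nhds 0) := by
    have hcont : Continuous fun d : ℝ => C * P.c₂ ^ c * P.γ₀ ^ (P.α * (c - P.μ) / 2) *
        (d - 1) ^ (b + -P.δ * (P.α * (c - P.μ) / 2)) :=
      continuous_const.mul (Continuous.rpow_const (by fun_prop) fun _ => Or.inr hexp.le)
    have := hcont.tendsto 1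
    rw [sub_self, Real.zero_rpow hexp.ne', mul_zero] at this
    exact this.mono_left nhdsWithin_le_nhds
  exact tendsto_of_tendsto_of_tendsto_of_le_of_le' tendsto_const_nhds hlim
    (eventually_nhdsWithin_of_forall hnonneg) (eventually_nhdsWithin_of_forall hbound)

theorem continuousOn_distTerm (hP : P.IsAdmissible) {b : ℝ} (hb : 0 < b) :
    ContinuousOn (P.distTerm b) (Ici 1) := by
  intro d hd
  rcases eq_or_lt_of_le (show (1 : ℝ) ≤ d from hd) with rfl | hd
  · rw [← Ioi_insert, continuousWithinAt_insert_self, ContinuousWithinAt]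
    convert hP.tendsto_distTerm_one hb using 2
    simp [distTerm, Real.zero_rpow hb.ne']
  · have hg := hP.gain_pos hd
    have hgc : ContinuousAt P.gain d := continuousOn_gain.continuousAt (Ioi_mem_nhds hd)
    have hgα := Real.rpow_pos_of_pos hg (P.α / 2)
    have hc₂ := hP.c₂_pos
    have hcap : ContinuousAt P.capacityH (1 / P.c₂ / P.gain d ^ (P.α / 2)) :=
      hP.isDecayProfile_capacityH.continuousOn.continuousAt (Ioi_mem_nhds (by positivity))
    have hcomp : ContinuousAt (fun d => P.capacityH (1 / P.c₂ / P.gain d ^ (P.α / 2))) d :=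
      ContinuousAt.comp (f := fun d => 1 / P.c₂ / P.gain d ^ (P.α / 2)) hcap
        (continuousAt_const.div (hgc.rpow_const (Or.inl hg.ne')) hgα.ne')
    refine ContinuousAt.continuousWithinAt (ContinuousAt.mul ?_
      ((hgc.rpow_const (Or.inl hg.ne')).mul hcomp))
    exact ContinuousAt.rpow_const (by fun_prop) (Or.inr hb.le)

/-- The change of variables between the quadrature interval `[-1, 1]` and the distance. -/
theorem Phi_mul_capacityH_eq (hP : P.IsAdmissible) (i : Fin P.l) {x : ℝ} (hx : -1 < x) :
    P.γ₀ ^ (-(P.α * P.μ / 2)) *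
        (P.Phi₁ i x * P.capacityH (P.Phi₂ x / (P.c₂ * P.γ₀ ^ (P.α / 2)))) =
      P.distTerm (P.b i) (P.R / (2 * P.d₀) * x + (P.R / (2 * P.d₀) + 1)) := by
  have hd₀ := hP.d₀_pos
  have hR := hP.R_pos
  have hγ₀ := hP.γ₀_pos
  have hc₂ := hP.c₂_pos
  have hx1 : 0 < x + 1 := by linarith
  set u := P.R / (2 * P.d₀) * (x + 1) with hu
  have hu0 : 0 < u := by positivity
  have hd : P.R / (2 * P.d₀) * x + (P.R / (2 * P.d₀) + 1) = u + 1 := by rw [hu]; ring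
  have hgain : ∀ e : ℝ, P.gain (u + 1) ^ e =
      P.γ₀ ^ e * u ^ (-P.δ * e) * Real.exp (-(P.κ * P.d₀ * (u + 1)) * e) := by
    intro e
    rw [gain, add_sub_cancel_right, Real.mul_rpow (by positivity) (by positivity),
      Real.mul_rpow hγ₀.le (by positivity), ← Real.rpow_mul hu0.le, Real.exp_mul]
  have harg : P.Phi₂ x / (P.c₂ * P.γ₀ ^ (P.α / 2)) = 1 / P.c₂ / P.gain (u + 1) ^ (P.α / 2) := by
    rw [hgain, Phi₂, Phi, ← hu, show -P.δ * (P.α / 2) = -(P.α * P.δ / 2) by ring,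
      Real.rpow_neg hu0.le, show -(P.κ * P.d₀ * (u + 1)) * (P.α / 2) =
        -(P.α / 2 * P.κ * P.d₀ * (u + 1)) by ring, Real.exp_neg]
    field_simp
  rw [harg, hd, distTerm, hgain (-(P.α * P.μ / 2)), add_sub_cancel_right, Phi₁, Phi, ← hu,
    Real.rpow_add hu0, show -P.δ * -(P.α * P.μ / 2) = P.α * P.μ * P.δ / 2 by ring,
    show -(P.κ * P.d₀ * (u + 1)) * -(P.α * P.μ / 2) = P.α / 2 * P.κ * P.μ * P.d₀ * (u + 1) by ring]
  ring

theorem integrableOn_distTerm (hP : P.IsAdmissible) {b : ℝ} (hb : 0 < b) :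
    IntegrableOn (P.distTerm b) (Ioo 1 (1 + P.R / P.d₀)) :=
  (((hP.continuousOn_distTerm hb).mono Icc_subset_Ici_self).integrableOn_Icc).mono_set
    Ioo_subset_Icc_self

/-- The quadrature sums in the closed form converge to integrals over the distance. -/
theorem tendsto_sum_glWeight_mul_distTerm (hP : P.IsAdmissible) {b : ℝ} (hb : 0 < b) :
    Filter.Tendsto (fun N => ∑ x ∈ glNodes N, glWeight N x *
        P.distTerm b (P.R / (2 * P.d₀) * x + (P.R / (2 * P.d₀) + 1))) Filter.atTop
      (nhds ((P.R / (2 * P.d₀))⁻¹ * ∫ d in Ioo 1 (1 + P.R / P.d₀), P.distTerm b d)) := by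
  have hd₀ := hP.d₀_pos
  have hR := hP.R_pos
  have hr : 0 < P.R / (2 * P.d₀) := by positivity
  have hcont : ContinuousOn (fun x => P.distTerm b (P.R / (2 * P.d₀) * x + (P.R / (2 * P.d₀) + 1)))
      (Icc (-1) 1) := by
    refine (hP.continuousOn_distTerm hb).comp (by fun_prop) fun x hx => ?_
    have : 0 ≤ P.R / (2 * P.d₀) * (x + 1) := mul_nonneg hr.le (by linarith [hx.1])
    simp only [mem_Ici]
    linarith
  have h := tendsto_sum_glWeight_mul hcont
  rw [intervalIntegral.integral_comp_mul_add _ hr.ne', smul_eq_mul,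
    intervalIntegral.integral_of_le (by linarith), integral_Ioc_eq_integral_Ioo,
    show P.R / (2 * P.d₀) * -1 + (P.R / (2 * P.d₀) + 1) = 1 by ring,
    show P.R / (2 * P.d₀) * 1 + (P.R / (2 * P.d₀) + 1) = 1 + P.R / P.d₀ by field_simp; ring] at h
  exact h

/-- The constant `R / (2 d₀)` is the ratio of the lengths of the two intervals of integration. -/
theorem tendsto_capacityClosedForm (hP : P.IsAdmissible) (hb : ∀ i, 0 < P.b i) :
    Filter.Tendsto P.capacityClosedForm Filter.atTop
      (nhds ((1 / Real.log 2 * (P.pdfVConst * ∑ i, P.distCoeff i *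
        ∫ d in Ioo 1 (1 + P.R / P.d₀), P.distTerm (P.b i) d) : ℝ) : ℂ)) := by
  have hd₀ := hP.d₀_pos
  have hR := hP.R_pos
  have h := (tendsto_finsetSum Finset.univ fun i _ =>
    (hP.tendsto_sum_glWeight_mul_distTerm (hb i)).const_mul (P.distCoeff i)).const_mul
    (1 / Real.log 2 * (P.pdfVConst * (P.R / (2 * P.d₀))))
  have hlim : 1 / Real.log 2 * (P.pdfVConst * (P.R / (2 * P.d₀))) * (∑ i, P.distCoeff i *
      ((P.R / (2 * P.d₀))⁻¹ * ∫ d in Ioo 1 (1 + P.R / P.d₀), P.distTerm (P.b i) d)) =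
      1 / Real.log 2 * (P.pdfVConst * ∑ i, P.distCoeff i *
        ∫ d in Ioo 1 (1 + P.R / P.d₀), P.distTerm (P.b i) d) := by
    simp only [Finset.mul_sum]
    refine Finset.sum_congr rfl fun i _ => ?_
    field_simp
  rw [hlim] at h
  refine ((Complex.continuous_ofReal.tendsto _).comp h).congr fun N => ?_
  rw [hP.capacityClosedForm_eq, Function.comp_apply]
  congr 1
  simp only [Finset.mul_sum]
  refine Finset.sum_congr rfl fun i _ => Finset.sum_congr rfl fun x hx => ?_
  rw [← hP.Phi_mul_capacityH_eq i (mem_Ioo_of_mem_glNodes hx).1, pdfVConst, distCoeff, nodeCoeff]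
  have h3 := (Real.log_pos one_lt_two).ne'
  have h4 := (Real.Gamma_pos_of_pos hP.a_pos).ne'
  field_simp
  ring

/-! ### Exchanging the integrals over the SNR and over the distance -/

theorem measurable_capacityIntegrand (hP : P.IsAdmissible) : Measurable P.capacityIntegrand := by
  have h1 := hP.isDecayProfile_densityH.measurable
  have h2 := measurable_gain (P := P)
  have h3 : Measurable P.pdfD := by
    unfold pdfD
    fun_prop
  unfold capacityIntegrand
  fun_prop

theorem integral_capacityIntegrand (hP : P.IsAdmissible) {d : ℝ} (hd : 1 < d) :
    ∫ γ in Ioi (0 : ℝ), P.capacityIntegrand (γ, d) =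
      P.pdfVConst * ∑ i, P.distCoeff i * P.distTerm (P.b i) d := by
  have hg := hP.gain_pos hd
  simp only [capacityIntegrand]
  rw [integral_const_mul, hP.integral_log_mul_densityH hg, ← pdfD_mul_eq_sum, sub_eq_add_neg,
    Real.rpow_add hg, Real.rpow_one]
  field_simp

theorem integral_norm_capacityIntegrand (hP : P.IsAdmissible) {d : ℝ} (hd : 1 < d) :
    ∫ γ in Ioi (0 : ℝ), ‖P.capacityIntegrand (γ, d)‖ =
      ‖P.pdfVConst * ∑ i, P.distCoeff i * P.distTerm (P.b i) d‖ := by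
  have hg := hP.gain_pos hd
  have hc₂ := hP.c₂_pos
  -- for fixed `d` the integrand has constant sign
  have h : ∀ γ ∈ Ioi (0 : ℝ), ‖P.capacityIntegrand (γ, d)‖ =
      ‖P.pdfVConst / P.gain d * P.pdfD d‖ * (Real.log (1 + γ) *
        ((γ / P.gain d) ^ (P.α * P.μ / 2 - 1) *
          P.densityH (1 / P.c₂ * (γ / P.gain d) ^ (P.α / 2)))) := by
    intro γ hγ
    have hγ : (0 : ℝ) < γ := hγ
    have h1 := Real.log_nonneg (by linarith : 1 ≤ 1 + γ)
    have h2 := hP.isDecayProfile_densityH.nonneg (1 / P.c₂ * (γ / P.gain d) ^ (P.α / 2))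
      (by positivity)
    rw [capacityIntegrand, norm_mul]
    congr 1
    exact Real.norm_of_nonneg (by positivity)
  have hcap := hP.isDecayProfile_capacityH.nonneg (1 / P.c₂ / P.gain d ^ (P.α / 2)) (by positivity)
  rw [← hP.integral_capacityIntegrand hd, setIntegral_congr_fun measurableSet_Ioi h]
  simp only [capacityIntegrand]
  rw [integral_const_mul, integral_const_mul, hP.integral_log_mul_densityH hg,
    norm_mul _ (P.gain d ^ (1 - P.α * P.μ / 2) * _)]
  congr 1
  exact (Real.norm_of_nonneg (by positivity)).symm

theorem integrable_capacityIntegrand (hP : P.IsAdmissible) (hb : ∀ i, 0 < P.b i) :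
    Integrable P.capacityIntegrand ((volume.restrict (Ioi 0)).prod
      (volume.restrict (Ioo 1 (1 + P.R / P.d₀)))) := by
  rw [integrable_prod_iff' hP.measurable_capacityIntegrand.aestronglyMeasurable]
  constructor
  · refine (ae_restrict_iff' measurableSet_Ioo).mpr (ae_of_all _ fun d hd => ?_)
    exact (hP.integrableOn_log_mul_densityH (hP.gain_pos hd.1)
      (one_div_pos.mpr hP.c₂_pos)).const_mul
      (P.pdfVConst / P.gain d * P.pdfD d)
  · have h : IntegrableOn (fun d => ‖P.pdfVConst * ∑ i, P.distCoeff i * P.distTerm (P.b i) d‖)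
        (Ioo 1 (1 + P.R / P.d₀)) :=
      ((integrable_finsetSum Finset.univ fun i _ =>
        (hP.integrableOn_distTerm (hb i)).const_mul (P.distCoeff i)).const_mul _).norm
    exact h.congr_fun (fun d hd => (hP.integral_norm_capacityIntegrand hd.1).symm) measurableSet_Ioo

theorem log_mul_pdfSNR_eq (hP : P.IsAdmissible) {γ : ℝ} (hγ : 0 < γ) :
    Real.log (1 + γ) * P.pdfSNR γ =
      ∫ d in Ioo 1 (1 + P.R / P.d₀), P.capacityIntegrand (γ, d) := by
  rw [pdfSNR, ← integral_const_mul]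
  refine setIntegral_congr_fun measurableSet_Ioo fun d hd => ?_
  simp only [capacityIntegrand]
  rw [hP.condPDF_eq hγ hd.1]
  ring

theorem integrableOn_log_mul_pdfSNR (hP : P.IsAdmissible) (hb : ∀ i, 0 < P.b i) :
    IntegrableOn (fun γ : ℝ => Real.log (1 + γ) * P.pdfSNR γ) (Ioi 0) :=
  IntegrableOn.congr_fun (hP.integrable_capacityIntegrand hb).integral_prod_left
    (fun _ hγ => (hP.log_mul_pdfSNR_eq hγ).symm) measurableSet_Ioi

theorem integral_log_mul_pdfSNR (hP : P.IsAdmissible) (hb : ∀ i, 0 < P.b i) :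
    ∫ γ in Ioi (0 : ℝ), Real.log (1 + γ) * P.pdfSNR γ =
      P.pdfVConst * ∑ i, P.distCoeff i *
        ∫ d in Ioo 1 (1 + P.R / P.d₀), P.distTerm (P.b i) d := by
  rw [setIntegral_congr_fun measurableSet_Ioi fun γ hγ => hP.log_mul_pdfSNR_eq hγ,
    integral_integral_swap (f := fun γ d => P.capacityIntegrand (γ, d))
      (hP.integrable_capacityIntegrand hb),
    setIntegral_congr_fun measurableSet_Ioo fun d hd => hP.integral_capacityIntegrand hd.1,
    integral_const_mul, integral_finsetSum Finset.univ fun i _ =>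
      (hP.integrableOn_distTerm (hb i)).const_mul (P.distCoeff i)]
  simp only [integral_const_mul]

end IsAdmissible

end Params

end THz

theorem mainTheorem5 (P : THz.Params)
    (hα : 0 < P.α) (hμ : 0 < P.μ) (hm : max (2 / P.α) 1 < P.m) (hβ : 2 < P.β)
    (hlam : 0 < P.lam) (hδ : P.δ ∈ Set.Icc (2 : ℝ) 6) (hγ₀ : 0 < P.γ₀) (hκ : 0 ≤ P.κ)
    (hd₀ : 0 < P.d₀) (hR : 0 < P.R) :
    -- the Mellin–Barnes integrals of the two H-functions converge and do not depend on the contour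
    (∀ z : ℝ, 0 < z → THz.FoxHWellDefined 3 1 P.pdfUpper P.pdfLower (z : ℂ) ∧
      THz.FoxHWellDefined 5 2 P.capUpper P.capLower (z : ℂ)) ∧
    -- the closed form of the capacity integral of the density in Gauss–Legendre form
    (∀ N : ℕ,
      MeasureTheory.IntegrableOn (fun γ : ℝ => (Real.log (1 + γ) : ℂ) * P.pdfSNRQuadrature N γ)
        (Set.Ioi 0) ∧
      (1 / Real.log 2 : ℂ) *
          ∫ γ in Set.Ioi (0 : ℝ), (Real.log (1 + γ) : ℂ) * P.pdfSNRQuadrature N γ =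
        P.capacityClosedForm N) ∧
    -- the closed form converges to the average capacity of the channel
    ((∀ i, 0 < P.b i) →
      MeasureTheory.IntegrableOn (fun γ : ℝ => Real.log (1 + γ) * P.pdfSNR γ) (Set.Ioi 0) ∧
      Filter.Tendsto P.capacityClosedForm Filter.atTop
        (nhds ((1 / Real.log 2 * ∫ γ in Set.Ioi (0 : ℝ), Real.log (1 + γ) * P.pdfSNR γ : ℝ) : ℂ))) := by
  have hP : P.IsAdmissible :=
    { α_pos := hα
      μ_pos := hμ
      one_lt_m := (le_max_right _ _).trans_lt hm
      β_pos := by linarith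
      lam_pos := hlam
      δ_pos := by linarith [hδ.1]
      κ_nonneg := hκ
      γ₀_pos := hγ₀
      d₀_pos := hd₀
      R_pos := hR }
  refine ⟨fun z hz => ⟨(P.foxH_pdf hα hμ hP.m_pos hP.β_pos hz).1,
    (P.foxH_cap hα hμ hP.m_pos hP.β_pos hz).1⟩, fun N => ⟨?_, ?_⟩, fun hb => ⟨?_, ?_⟩⟩
  · exact hP.integrableOn_log_mul_pdfSNRQuadrature N
  · exact hP.integral_log_mul_pdfSNRQuadrature N
  · exact hP.integrableOn_log_mul_pdfSNR hb
  · rw [hP.integral_log_mul_pdfSNR hb]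
    exact hP.tendsto_capacityClosedForm hb
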